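/- Let $R$ be an associative ring with identity (not necessarily commutative). Suppose that $R$ is right coherent (every finitely generated right ideal is finitely presented) and semi-primary with radical $N$, that is, $N$ is a two-sided nilpotent ideal of $R$ such that $R/N$ is a semisimple ring. A left $R$-module $M$ is called Gorenstein flat if there is an exact sequence $$\mathbf{F}:\ \cdots\to F_1\to F_0\to F^0\to F^1\to\cdots$$ of flat left $R$-modules such that $M\cong \operatorname{Im}(F_0\to F^0)$ and $I\otimes_R\mathbf{F}$ is exact for every injective right $R$-module $I$. The Gorenstein flat dimension $\operatorname{Gfd}_R(M)\in\mathbb{N}\cup\{\infty\}$ of a left $R$-module $M$ is the least $n\ge 0$ for which there is an exact sequence $0\to G_n\to\cdots\to G_0\to M\to 0$ of left $R$-modules with all $G_i$ Gorenstein flat, and $\infty$ if no such $n$ exists. The left Gorenstein weak dimension of $R$ is $\operatorname{l.wGgldim}(R)=\sup\{\operatorname{Gfd}_R(M)\mid M \text{ a left } R\text{-module}\}$. Then $$\operatorname{l.wGgldim}(R)=\operatorname{Gfd}_R(R/N)=\sup_C \operatorname{Gfd}_R(C),$$ where $C$ ranges over all simple left $R$-modules (a supremum over the empty set being $0$). 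-/

import Mathlib

open scoped TensorProduct MulOpposite

universe u

/-! Left `R`-modules are `Module R M`, right `R`-modules are `Module Rᵐᵒᵖ I`,
with `x · r` written `MulOpposite.op r • x`. The ring `R` need not be commutative. -/

/-- The subgroup of `I ⊗[ℤ] M` generated by all `(x · r) ⊗ m - x ⊗ (r • m)`. -/
def balancedRel (R : Type*) [Ring R] (I : Type*) [AddCommGroup I] [Module Rᵐᵒᵖ I]
    (M : Type*) [AddCommGroup M] [Module R M] : AddSubgroup (I ⊗[ℤ] M) :=
  AddSubgroup.closure {t | ∃ (x : I) (r : R) (m : M),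
    t = (MulOpposite.op r • x) ⊗ₜ[ℤ] m - x ⊗ₜ[ℤ] (r • m)}

/-- The tensor product `I ⊗_R M` (an abelian group) of a right `R`-module `I` and a left
`R`-module `M`. -/
abbrev BalancedTensor (R : Type*) [Ring R] (I : Type*) [AddCommGroup I] [Module Rᵐᵒᵖ I]
    (M : Type*) [AddCommGroup M] [Module R M] : Type _ :=
  (I ⊗[ℤ] M) ⧸ balancedRel R I M

/-- The map `g ⊗_R f : I ⊗_R M → I' ⊗_R M'`. -/
def BalancedTensor.map {R : Type*} [Ring R]
    {I : Type*} [AddCommGroup I] [Module Rᵐᵒᵖ I] {I' : Type*} [AddCommGroup I'] [Module Rᵐᵒᵖ I']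
    {M : Type*} [AddCommGroup M] [Module R M] {M' : Type*} [AddCommGroup M'] [Module R M']
    (g : I →ₗ[Rᵐᵒᵖ] I') (f : M →ₗ[R] M') : BalancedTensor R I M →+ BalancedTensor R I' M' :=
  QuotientAddGroup.map (balancedRel R I M) (balancedRel R I' M')
    (TensorProduct.map g.toAddMonoidHom.toIntLinearMap
      f.toAddMonoidHom.toIntLinearMap).toAddMonoidHom (by
      rw [balancedRel, AddSubgroup.closure_le]
      rintro _ ⟨x, r, m, rfl⟩
      refine AddSubgroup.subset_closure ⟨g x, r, f m, ?_⟩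
      simp)

/-- A left `R`-module `M` is flat if `- ⊗_R M` preserves injectivity of maps of right
`R`-modules. -/
def IsFlatLeft (R : Type u) [Ring R] (M : Type u) [AddCommGroup M] [Module R M] : Prop :=
  ∀ (A B : Type u) [AddCommGroup A] [Module Rᵐᵒᵖ A] [AddCommGroup B] [Module Rᵐᵒᵖ B]
    (g : A →ₗ[Rᵐᵒᵖ] B), Function.Injective g →
    Function.Injective (BalancedTensor.map g (LinearMap.id : M →ₗ[R] M))

/-- A left `R`-module `M` is Gorenstein flat if there is an exact sequence
`⋯ → F (-1) → F 0 → F 1 → ⋯` of flat left `R`-modules that stays exact under `I ⊗_R -` for every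
injective right `R`-module `I`, and such that `M` is isomorphic to the image of `F 0 → F 1`. -/
def IsGorensteinFlat (R : Type u) [Ring R] (M : Type u) [AddCommGroup M] [Module R M] : Prop :=
  ∃ (F : ℤ → ModuleCat.{u} R) (d : ∀ i, F i →ₗ[R] F (i + 1)),
    (∀ i, IsFlatLeft R (F i)) ∧
    (∀ i, Function.Exact (d i) (d (i + 1))) ∧
    (∀ (I : Type u) [AddCommGroup I] [Module Rᵐᵒᵖ I], Module.Injective Rᵐᵒᵖ I →
      ∀ i, Function.Exact (BalancedTensor.map (LinearMap.id : I →ₗ[Rᵐᵒᵖ] I) (d i))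
        (BalancedTensor.map (LinearMap.id : I →ₗ[Rᵐᵒᵖ] I) (d (i + 1)))) ∧
    Nonempty (M ≃ₗ[R] LinearMap.range (d 0))

/-- There is an exact sequence `0 → G n → ⋯ → G 1 → G 0 → M → 0` of left `R`-modules with all
`G i` Gorenstein flat (the sequence is continued by zero modules beyond `n`). -/
def HasGorensteinFlatResolution (R : Type u) [Ring R] (M : Type u) [AddCommGroup M] [Module R M]
    (n : ℕ) : Prop :=
  ∃ (G : ℕ → ModuleCat.{u} R) (d : ∀ i, G (i + 1) →ₗ[R] G i) (ε : G 0 →ₗ[R] M),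
    (∀ i, IsGorensteinFlat R (G i)) ∧
    (∀ i, n < i → Subsingleton (G i)) ∧
    Function.Surjective ε ∧
    Function.Exact (d 0) ε ∧
    ∀ i, Function.Exact (d (i + 1)) (d i)

/-- The Gorenstein flat dimension of a left `R`-module: the least length of a resolution by
Gorenstein flat modules, and `⊤` if there is no finite one. -/
noncomputable def gorensteinFlatDim (R : Type u) [Ring R] (M : Type u) [AddCommGroup M]
    [Module R M] : ℕ∞ :=
  ⨅ (n : ℕ) (_ : HasGorensteinFlatResolution R M n), (n : ℕ∞)

/-- The left Gorenstein weak dimension of `R`: the supremum of the Gorenstein flat dimensions of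
all left `R`-modules. -/
noncomputable def leftGorensteinWeakDim (R : Type u) [Ring R] : ℕ∞ :=
  ⨆ M : ModuleCat.{u} R, gorensteinFlatDim R M

/-- `R` is right coherent: each finitely generated right ideal is finitely presented. -/
def IsRightCoherent (R : Type u) [Ring R] : Prop :=
  ∀ J : Submodule Rᵐᵒᵖ R, J.FG → Module.FinitePresentation Rᵐᵒᵖ J

/-- `R` is semi-primary with radical `N`: the two-sided ideal `N` is nilpotent and `R ⧸ N` is a
semisimple ring. -/
structure IsSemiprimaryWithRadical (R : Type u) [Ring R] (N : Ideal R) [N.IsTwoSided] : Prop where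
  isNilpotent : IsNilpotent N
  isSemisimpleRing : IsSemisimpleRing (R ⧸ N)

/-!
Right modules are traded for left ones through the duality `X⋆ = Hom_ℤ(X, ℚ/ℤ)`: there is an
adjunction `Hom_R(M, I⋆) ≃ Hom(I, M⋆)`, both sides being the dual of `I ⊗_R M`. Hence `M` is flat if
and only if `M⋆` is injective (`isFlatLeft_iff_injective`), `I ⊗_R -` keeps a complex exact if and
only if `Hom_R(-, I⋆)` does (`BalancedTensor.exact_map_iff`), and the vanishing of `Tor_n(I, M)` is
that of `Extⁿ(M, I⋆)`. Right coherence enters through the fact that `I⋆` is flat for `I` injective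
(`IsRightCoherent.isFlatLeft_characterModule`); so a flat `F` embeds with flat cokernel in `F⋆⋆`,
into which maps from submodules extend whenever the quotient is orthogonal to the injectives.

Splicing with a projective resolution, `M` is Gorenstein flat if and only if it lies in a class of
modules with vanishing `Tor` each of which embeds in a flat module with cokernel in the class
(`IsCoresolvedClass`). For this one-sided description, closure under extensions
(`IsGorensteinFlat.of_isShortExact`) is a horseshoe argument with coresolutions by modules `I⋆`;
closure under kernels of surjections follows by Noether's isomorphism theorem, and closure under
direct sums is clear. All three closure properties pass to the modules of dimension at most `n`
(`GorensteinFlatDimLE.iff_of_isShortExact`, `GorensteinFlatDimLE.dfinsupp`), and Eilenberg's swindle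
then gives closure under direct summands (`GorensteinFlatDimLE.of_prod`).

Now let `R` be semi-primary. A bound for the simple modules carries over to direct sums of these,
that is, to the modules killed by `N`, and by the finite filtration by the `Nⁱ M` to all modules
(`IsSemiprimaryWithRadical.gorensteinFlatDimLE`). Conversely, each simple module is a direct summand
of `R ⧸ N` (`IsSemiprimaryWithRadical.exists_prod_equiv`).
-/

open MulOpposite (op)

/-! ### Short exact sequences of modules -/

/-- `0 → A → B → C → 0` is exact. -/
structure IsShortExact {R : Type*} [Ring R] {A B C : Type*} [AddCommGroup A] [AddCommGroup B]
    [AddCommGroup C] [Module R A] [Module R B] [Module R C] (f : A →ₗ[R] B) (g : B →ₗ[R] C) :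
    Prop where
  injective : Function.Injective f
  exact : Function.Exact f g
  surjective : Function.Surjective g

namespace IsShortExact

section Basic

variable {R : Type*} [Ring R] {A B C X : Type*} [AddCommGroup A] [AddCommGroup B]
    [AddCommGroup C] [AddCommGroup X] [Module R A] [Module R B] [Module R C] [Module R X]
    {f : A →ₗ[R] B} {g : B →ₗ[R] C}

lemma of_surjective (hg : Function.Surjective g) : IsShortExact (LinearMap.ker g).subtype g :=
  ⟨Subtype.val_injective, LinearMap.exact_subtype_ker_map g, hg⟩

lemma of_injective (hf : Function.Injective f) : IsShortExact f (LinearMap.range f).mkQ :=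
  ⟨hf, LinearMap.exact_map_mkQ_range f, Submodule.mkQ_surjective _⟩

lemma apply_apply (h : IsShortExact f g) (a : A) : g (f a) = 0 := h.exact.apply_apply_eq_zero a

/-- Maps that kill `A` descend to `C`. -/
lemma exists_desc (h : IsShortExact f g) (k : B →ₗ[R] X) (hk : ∀ a, k (f a) = 0) :
    ∃ l : C →ₗ[R] X, ∀ b, l (g b) = k b := by
  have hker : LinearMap.ker g ≤ LinearMap.ker k := by
    intro b hb
    obtain ⟨a, rfl⟩ := (h.exact b).1 hb
    exact hk a
  refine ⟨(LinearMap.ker g).liftQ k hker ∘ₗ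
    (g.quotKerEquivOfSurjective h.surjective).symm.toLinearMap, fun b ↦ ?_⟩
  have : (g.quotKerEquivOfSurjective h.surjective).symm (g b) = (LinearMap.ker g).mkQ b := by
    rw [LinearEquiv.symm_apply_eq]
    rfl
  simp [this]

/-- Maps to `B` that die in `C` lift to `A`. -/
lemma exists_lift (h : IsShortExact f g) (k : X →ₗ[R] B) (hk : ∀ x, g (k x) = 0) :
    ∃ l : X →ₗ[R] A, ∀ x, f (l x) = k x := by
  let e := LinearEquiv.ofInjective f h.injective
  let k' : X →ₗ[R] LinearMap.range f := k.codRestrict _ fun x ↦ (h.exact _).1 (hk x)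
  refine ⟨e.symm.toLinearMap ∘ₗ k', fun x ↦ ?_⟩
  have : e (e.symm (k' x)) = k' x := e.apply_symm_apply _
  exact congrArg Subtype.val this

end Basic

variable {R : Type u} [Ring R] {A B C D F : ModuleCat.{u} R} {f : A →ₗ[R] B} {g : B →ₗ[R] C}

/-- Noether's isomorphism `(F / A) / (B / A) ≅ F / B` for `A ≤ B ≤ F`. -/
lemma exists_third_iso (h : IsShortExact f g) {i : B →ₗ[R] F} {p : F →ₗ[R] D}
    (h' : IsShortExact i p) : ∃ (Q : ModuleCat.{u} R) (q : F →ₗ[R] Q) (j : C →ₗ[R] Q)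
      (r : Q →ₗ[R] D), IsShortExact (i ∘ₗ f) q ∧ IsShortExact j r := by
  have hQ := of_injective (f := i ∘ₗ f) (h'.injective.comp h.injective)
  set q := (LinearMap.range (i ∘ₗ f)).mkQ
  obtain ⟨j, hj⟩ := h.exists_desc (q ∘ₗ i) hQ.apply_apply
  obtain ⟨r, hr⟩ := hQ.exists_desc p fun a ↦ h'.apply_apply _
  refine ⟨ModuleCat.of R (F ⧸ LinearMap.range (i ∘ₗ f)), q, j, r, hQ, ⟨?_, ?_, ?_⟩⟩
  · rw [injective_iff_map_eq_zero]
    intro c hc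
    obtain ⟨b, rfl⟩ := h.surjective c
    rw [hj] at hc
    obtain ⟨a, ha⟩ := (hQ.exact _).1 hc
    rw [← h'.injective ha, h.apply_apply]
  · intro y
    obtain ⟨x, rfl⟩ := hQ.surjective y
    rw [hr]
    constructor
    · intro hx
      obtain ⟨b, rfl⟩ := (h'.exact x).1 hx
      exact ⟨g b, hj b⟩
    · rintro ⟨c, hc⟩
      obtain ⟨b, rfl⟩ := h.surjective c
      rw [← hr, ← hc, hj]
      exact (hr _).trans (h'.apply_apply b)
  · intro d
    obtain ⟨x, rfl⟩ := h'.surjective d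
    exact ⟨q x, hr x⟩

lemma exists_pushout (h : IsShortExact f g) {i : A →ₗ[R] F} {p : F →ₗ[R] D}
    (h' : IsShortExact i p) : ∃ (P : ModuleCat.{u} R) (j : F →ₗ[R] P) (q : P →ₗ[R] C)
      (k : B →ₗ[R] P) (r : P →ₗ[R] D), IsShortExact j q ∧ IsShortExact k r := by
  have hP := of_injective (f := f.prod (-i)) fun a a' haa' ↦ h.injective (congrArg Prod.fst haa')
  set π := (LinearMap.range (f.prod (-i))).mkQ
  obtain ⟨q, hq⟩ := hP.exists_desc (g ∘ₗ LinearMap.fst R B F) fun a ↦ h.apply_apply a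
  obtain ⟨r, hr⟩ := hP.exists_desc (p ∘ₗ LinearMap.snd R B F) fun a ↦ by
    simp [h'.apply_apply]
  refine ⟨ModuleCat.of R ((B × F) ⧸ LinearMap.range (f.prod (-i))), π ∘ₗ LinearMap.inr R B F, q,
    π ∘ₗ LinearMap.inl R B F, r, ⟨?_, ?_, ?_⟩, ⟨?_, ?_, ?_⟩⟩
  · rw [injective_iff_map_eq_zero]
    intro x hx
    obtain ⟨a, ha⟩ := (hP.exact _).1 hx
    have h1 : f a = 0 := congrArg Prod.fst ha
    have h2 : -i a = x := congrArg Prod.snd ha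
    rw [← h2, (map_eq_zero_iff f h.injective).1 h1, map_zero, neg_zero]
  · intro y
    obtain ⟨⟨b, x⟩, rfl⟩ := hP.surjective y
    rw [hq]
    constructor
    · intro hb
      obtain ⟨a, rfl⟩ := (h.exact b).1 hb
      refine ⟨x + i a, ?_⟩
      change π (0, x + i a) = π (f a, x)
      rw [← sub_eq_zero, ← map_sub]
      refine (hP.exact _).2 ⟨-a, ?_⟩
      simp
    · rintro ⟨x', hx'⟩
      rw [← hq, ← hx']
      exact (hq (0, x')).trans (map_zero g)
  · intro c
    obtain ⟨b, rfl⟩ := h.surjective c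
    exact ⟨π (b, 0), hq _⟩
  · rw [injective_iff_map_eq_zero]
    intro b hb
    obtain ⟨a, ha⟩ := (hP.exact _).1 hb
    have h1 : f a = b := congrArg Prod.fst ha
    have h2 : -i a = 0 := congrArg Prod.snd ha
    rw [← h1, (map_eq_zero_iff i h'.injective).1 (neg_eq_zero.1 h2), map_zero]
  · intro y
    obtain ⟨⟨b, x⟩, rfl⟩ := hP.surjective y
    rw [hr]
    constructor
    · intro hx
      obtain ⟨a, rfl⟩ := (h'.exact x).1 hx
      refine ⟨b + f a, ?_⟩
      change π (b + f a, 0) = π (b, i a)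
      rw [← sub_eq_zero, ← map_sub]
      refine (hP.exact _).2 ⟨a, ?_⟩
      simp
    · rintro ⟨b', hb'⟩
      rw [← hr, ← hb']
      exact (hr (b', 0)).trans (map_zero p)
  · intro d
    obtain ⟨x, rfl⟩ := h'.surjective d
    exact ⟨π (0, x), hr _⟩

lemma exists_pullback (h : IsShortExact f g) {i : D →ₗ[R] F} {p : F →ₗ[R] C}
    (h' : IsShortExact i p) : ∃ (P : ModuleCat.{u} R) (j : A →ₗ[R] P) (q : P →ₗ[R] F)
      (k : D →ₗ[R] P) (r : P →ₗ[R] B), IsShortExact j q ∧ IsShortExact k r := by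
  let P := LinearMap.eqLocus (g ∘ₗ LinearMap.fst R B F) (p ∘ₗ LinearMap.snd R B F)
  let j : A →ₗ[R] P := (LinearMap.inl R B F ∘ₗ f).codRestrict P fun a ↦
    (h.apply_apply a).trans (map_zero p).symm
  let k : D →ₗ[R] P := (LinearMap.inr R B F ∘ₗ i).codRestrict P fun a ↦
    (map_zero g).trans (h'.apply_apply a).symm
  refine ⟨ModuleCat.of R P, j, LinearMap.snd R B F ∘ₗ P.subtype, k,
    LinearMap.fst R B F ∘ₗ P.subtype, ⟨?_, ?_, ?_⟩, ⟨?_, ?_, ?_⟩⟩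
  · intro a a' haa'
    exact h.injective (congrArg (fun x : P ↦ x.1.1) haa')
  · rintro ⟨⟨b, x⟩, hbx : g b = p x⟩
    constructor
    · rintro (rfl : x = 0)
      obtain ⟨a, rfl⟩ := (h.exact b).1 (hbx.trans (map_zero p))
      exact ⟨a, rfl⟩
    · rintro ⟨a, ha⟩
      exact (congrArg (fun x : P ↦ x.1.2) ha).symm
  · intro x
    obtain ⟨b, hb⟩ := h.surjective (p x)
    exact ⟨⟨(b, x), hb⟩, rfl⟩
  · intro a a' haa'
    exact h'.injective (congrArg (fun x : P ↦ x.1.2) haa')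
  · rintro ⟨⟨b, x⟩, hbx : g b = p x⟩
    constructor
    · rintro (rfl : b = 0)
      obtain ⟨a, rfl⟩ := (h'.exact x).1 (hbx.symm.trans (map_zero g))
      exact ⟨a, rfl⟩
    · rintro ⟨a, ha⟩
      exact (congrArg (fun x : P ↦ x.1.1) ha).symm
  · intro b
    obtain ⟨x, hx⟩ := h'.surjective (g b)
    exact ⟨⟨(b, x), hx.symm⟩, rfl⟩

/-- The horseshoe lemma, for a cover of `C` by a projective module. -/
lemma exists_horseshoe (h : IsShortExact f g) {K P K' P' : ModuleCat.{u} R} {k : K →ₗ[R] P}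
    {α : P →ₗ[R] A} (hα : IsShortExact k α) {k' : K' →ₗ[R] P'} {γ : P' →ₗ[R] C}
    (hγ : IsShortExact k' γ) [Module.Projective R P'] :
    ∃ (L : ModuleCat.{u} R) (l : L →ₗ[R] P × P') (β : P × P' →ₗ[R] B) (s : K →ₗ[R] L)
      (t : L →ₗ[R] K'), IsShortExact l β ∧ IsShortExact s t := by
  obtain ⟨γ', hγ'⟩ := Module.projective_lifting_property g γ h.surjective
  have hγ' : ∀ y, g (γ' y) = γ y := LinearMap.congr_fun hγ'
  let β : P × P' →ₗ[R] B := (f ∘ₗ α).coprod γ'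
  have hβ : ∀ x, β x = f (α x.1) + γ' x.2 := fun _ ↦ rfl
  have hsurj : Function.Surjective β := by
    intro b
    obtain ⟨y, hy⟩ := hγ.surjective (g b)
    obtain ⟨a, ha⟩ := (h.exact (b - γ' y)).1 (by rw [map_sub, hγ', hy, sub_self])
    obtain ⟨x, rfl⟩ := hα.surjective a
    exact ⟨(x, y), by rw [hβ, ha, sub_add_cancel]⟩
  have hγβ : ∀ x, γ x.2 = g (β x) := fun x ↦ by
    rw [hβ, map_add, h.apply_apply, zero_add, hγ']
  have hL := of_surjective hsurj
  obtain ⟨s, hs⟩ := hL.exists_lift (LinearMap.inl R P P' ∘ₗ k) fun x ↦ by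
    change β (k x, 0) = 0
    simp [hβ, hα.apply_apply]
  obtain ⟨t, ht⟩ := hγ.exists_lift (LinearMap.snd R P P' ∘ₗ (LinearMap.ker β).subtype) fun x ↦ by
    change γ (x.1.2) = 0
    rw [hγβ, x.2, map_zero]
  refine ⟨ModuleCat.of R (LinearMap.ker β), _, β, s, t, hL, ⟨?_, ?_, ?_⟩⟩
  · intro x y hxy
    apply hα.injective
    have := congrArg Prod.fst ((hs x).symm.trans ((congrArg Subtype.val hxy).trans (hs y)))
    exact this
  · intro x
    constructor
    · intro hx
      have h2 : x.1.2 = 0 := by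
        change (LinearMap.snd R P P' ∘ₗ (LinearMap.ker β).subtype) x = 0
        rw [← ht, hx, map_zero]
      have h1 : f (α x.1.1) = 0 := by
        have := hβ x
        rwa [h2, map_zero, add_zero, x.2, eq_comm] at this
      obtain ⟨y, hy⟩ := (hα.exact _).1 ((map_eq_zero_iff f h.injective).1 h1)
      refine ⟨y, Subtype.ext ?_⟩
      refine (hs y).trans ?_
      change (k y, 0) = x.1
      rw [hy, ← h2]
    · rintro ⟨y, rfl⟩
      apply hγ.injective
      rw [ht, map_zero]
      exact congrArg Prod.snd (hs y)
  · intro y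
    obtain ⟨a, ha⟩ := (h.exact (γ' (k' y))).1 (by rw [hγ', hγ.apply_apply])
    obtain ⟨x, rfl⟩ := hα.surjective a
    refine ⟨⟨(-x, k' y), ?_⟩, hγ.injective ?_⟩
    · rw [LinearMap.mem_ker, hβ, map_neg, map_neg, ha, neg_add_cancel]
    · exact ht _

/-- The dual horseshoe lemma, for an embedding of `A` that extends to `B`. -/
lemma exists_cohorseshoe (h : IsShortExact f g) {E L E' L' : ModuleCat.{u} R} {i : A →ₗ[R] E}
    {p : E →ₗ[R] L} (hi : IsShortExact i p) {j : C →ₗ[R] E'} {r : E' →ₗ[R] L'}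
    (hj : IsShortExact j r) (i' : B →ₗ[R] E) (hi' : ∀ a, i' (f a) = i a) :
    ∃ (Q : ModuleCat.{u} R) (l : B →ₗ[R] E × E') (q : E × E' →ₗ[R] Q) (s : L →ₗ[R] Q)
      (t : Q →ₗ[R] L'), IsShortExact l q ∧ IsShortExact s t := by
  let l : B →ₗ[R] E × E' := i'.prod (j ∘ₗ g)
  have hl : ∀ b, l b = (i' b, j (g b)) := fun _ ↦ rfl
  have hlf : ∀ a, l (f a) = (i a, 0) := fun a ↦ by rw [hl, hi', h.apply_apply, map_zero]
  have hinj : Function.Injective l := by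
    rw [injective_iff_map_eq_zero]
    intro b hb
    obtain ⟨a, rfl⟩ := (h.exact b).1 ((map_eq_zero_iff j hj.injective).1 (congrArg Prod.snd hb))
    rw [hlf] at hb
    rw [(map_eq_zero_iff i hi.injective).1 (congrArg Prod.fst hb), map_zero]
  have hQ := of_injective hinj
  set q := (LinearMap.range l).mkQ
  obtain ⟨s, hs⟩ := hi.exists_desc (q ∘ₗ LinearMap.inl R E E') fun a ↦
    (congrArg q (hlf a)).symm.trans (hQ.apply_apply (f a))
  obtain ⟨t, ht⟩ := hQ.exists_desc (r ∘ₗ LinearMap.snd R E E') fun b ↦ hj.apply_apply _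
  have hs : ∀ x, s (p x) = q (x, 0) := hs
  have ht : ∀ x, t (q x) = r x.2 := ht
  refine ⟨ModuleCat.of R ((E × E') ⧸ LinearMap.range l), l, q, s, t, hQ, ⟨?_, ?_, ?_⟩⟩
  · rw [injective_iff_map_eq_zero]
    intro y hy
    obtain ⟨x, rfl⟩ := hi.surjective y
    rw [hs] at hy
    obtain ⟨b, hb⟩ := (hQ.exact _).1 hy
    obtain ⟨a, rfl⟩ := (h.exact b).1 ((map_eq_zero_iff j hj.injective).1 (congrArg Prod.snd hb))
    rw [hlf] at hb
    have : i a = x := congrArg Prod.fst hb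
    rw [← this, hi.apply_apply]
  · intro y
    obtain ⟨⟨x, x'⟩, rfl⟩ := hQ.surjective y
    rw [ht]
    constructor
    · intro hx
      obtain ⟨c, rfl⟩ := (hj.exact _).1 hx
      obtain ⟨b, rfl⟩ := h.surjective c
      refine ⟨p (x - i' b), ?_⟩
      rw [hs, ← sub_eq_zero, ← map_sub]
      exact (hQ.exact _).2 ⟨-b, by simp [hl]⟩
    · rintro ⟨z, hz⟩
      obtain ⟨z, rfl⟩ := hi.surjective z
      rw [← ht, ← hz, hs, ht, map_zero]
  · intro y
    obtain ⟨x, rfl⟩ := hj.surjective y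
    exact ⟨q (0, x), ht _⟩

/-- Direct sums are exact. -/
lemma mapRange {J : Type u} [DecidableEq J] {A B C : J → ModuleCat.{u} R}
    {f : ∀ j, A j →ₗ[R] B j} {g : ∀ j, B j →ₗ[R] C j} (h : ∀ j, IsShortExact (f j) (g j)) :
    IsShortExact (DFinsupp.mapRange.linearMap f) (DFinsupp.mapRange.linearMap g) := by
  refine ⟨?_, ?_, ?_⟩
  · exact (DFinsupp.mapRange_injective _ fun j ↦ map_zero (f j)).2 fun j ↦ (h j).injective
  · rw [LinearMap.exact_iff, DFinsupp.ker_mapRangeLinearMap, DFinsupp.range_mapRangeLinearMap]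
    simp only [fun j ↦ (h j).exact.linearMap_ker_eq]
  · exact (DFinsupp.mapRange_surjective _ fun j ↦ map_zero (g j)).2 fun j ↦ (h j).surjective

lemma exists_projective_presentation (M : ModuleCat.{u} R) :
    ∃ (K P : ModuleCat.{u} R) (k : K →ₗ[R] P) (π : P →ₗ[R] M), Module.Projective R P ∧
      IsShortExact k π := by
  have hs := Finsupp.linearCombination_id_surjective R M
  exact ⟨ModuleCat.of R _, ModuleCat.of R (M →₀ R), _, _,
    inferInstanceAs (Module.Projective R (M →₀ R)), of_surjective hs⟩

end IsShortExact

/-! ### Character modules over a noncommutative ring -/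

/-- The character module of a right module `I` is a left module by `(r • c) x = c (x · r)`. -/
instance CharacterModule.instModuleOfRight {R : Type*} [Ring R] {I : Type*} [AddCommGroup I]
    [Module Rᵐᵒᵖ I] : Module R (CharacterModule I) where
  smul r c := AddMonoidHom.comp c (DistribSMul.toAddMonoidHom I (op r))
  one_smul c := by
    ext x
    exact congrArg c (one_smul _ x)
  mul_smul r s c := by
    ext x
    exact congrArg c (mul_smul (op s) (op r) x)
  smul_zero r := rfl
  smul_add r c d := rfl
  add_smul r s c := by
    ext x
    exact (congrArg c (add_smul (op r) (op s) x)).trans (map_add c _ _)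
  zero_smul c := by
    ext x
    exact (congrArg c (zero_smul _ x)).trans (map_zero c)

/-- The character module of a left module `M` is a right module by `(c · r) m = c (r • m)`. -/
instance CharacterModule.instModuleOfLeft {R : Type*} [Ring R] {M : Type*} [AddCommGroup M]
    [Module R M] : Module Rᵐᵒᵖ (CharacterModule M) where
  smul r c := AddMonoidHom.comp c (DistribSMul.toAddMonoidHom M r.unop)
  one_smul c := by
    ext x
    exact congrArg c (one_smul R x)
  mul_smul r s c := by
    ext x
    exact congrArg c (mul_smul s.unop r.unop x)
  smul_zero r := rfl
  smul_add r c d := rfl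
  add_smul r s c := by
    ext x
    exact (congrArg c (add_smul r.unop s.unop x)).trans (map_add c _ _)
  zero_smul c := by
    ext x
    exact (congrArg c (zero_smul R x)).trans (map_zero c)

section Duality

variable {R : Type*} [Ring R] {I : Type*} [AddCommGroup I] [Module Rᵐᵒᵖ I]
  {M : Type*} [AddCommGroup M] [Module R M] {M' : Type*} [AddCommGroup M'] [Module R M']

namespace CharacterModule

lemma sum_apply' {A : Type*} [AddCommGroup A] {ι : Type*} (s : Finset ι)
    (c : ι → CharacterModule A) (a : A) : (∑ i ∈ s, c i) a = ∑ i ∈ s, c i a :=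
  map_sum (AddMonoidHom.mk' (fun c : CharacterModule A ↦ c a) fun _ _ ↦ rfl) c s

/-- A character as a homomorphism of additive groups. -/
def hom {A : Type*} [AddCommGroup A] (c : CharacterModule A) : A →+ AddCircle (1 : ℚ) := c

/-- Characters extend along injections: a character that kills `ker T` factors through `T`. -/
lemma exists_comp_eq_of_ker_le {X Y : Type*} [AddCommGroup X] [AddCommGroup Y] (T : X →+ Y)
    (H : X →+ AddCircle (1 : ℚ)) (h : ∀ x, T x = 0 → H x = 0) :
    ∃ c : Y →+ AddCircle (1 : ℚ), ∀ x, c (T x) = H x := by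
  obtain ⟨c, hc⟩ := (Module.Baer.of_divisible (AddCircle (1 : ℚ))).extension_property_addMonoidHom
    (QuotientAddGroup.kerLift T) (QuotientAddGroup.kerLift_injective T)
    (QuotientAddGroup.lift T.ker H h)
  exact ⟨c, fun x ↦ DFunLike.congr_fun hc (x : X ⧸ T.ker)⟩

/-- Characters separate points from subgroups. -/
lemma exists_apply_ne_zero_of_notMem {X : Type*} [AddCommGroup X] (S : AddSubgroup X) {x : X}
    (hx : x ∉ S) : ∃ c : X →+ AddCircle (1 : ℚ), (∀ y ∈ S, c y = 0) ∧ c x ≠ 0 := by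
  have hx' : (x : X ⧸ S) ≠ 0 := fun h ↦ hx ((QuotientAddGroup.eq_zero_iff x).1 h)
  obtain ⟨c, hc⟩ := exists_character_apply_ne_zero_of_ne_zero hx'
  refine ⟨AddMonoidHom.comp c (QuotientAddGroup.mk' S), fun y hy ↦ ?_, hc⟩
  change c (y : X ⧸ S) = 0
  rw [(QuotientAddGroup.eq_zero_iff y).2 hy]
  exact map_zero c

/-- The contravariant action on linear maps of the duality from left to right modules. -/
def dualLeft (f : M →ₗ[R] M') : CharacterModule M' →ₗ[Rᵐᵒᵖ] CharacterModule M where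
  toFun c := AddMonoidHom.comp c f.toAddMonoidHom
  map_add' _ _ := rfl
  map_smul' r c := by
    ext x
    exact congrArg c (f.map_smul r.unop x).symm

/-- The adjunction `Hom_R(M, I⋆) ≃ Hom_{Rᵐᵒᵖ}(I, M⋆)`, from left to right. -/
def flipToRight (φ : M →ₗ[R] CharacterModule I) : I →ₗ[Rᵐᵒᵖ] CharacterModule M where
  toFun x := (AddMonoidHom.mk' (fun m ↦ φ m x) fun a b ↦ by rw [map_add]; rfl :
    M →+ AddCircle (1 : ℚ))
  map_add' x y := by
    ext m
    exact map_add (φ m) x y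
  map_smul' r x := by
    ext m
    exact (DFunLike.congr_fun (φ.map_smul r.unop m) x).symm

lemma flipToRight_apply (φ : M →ₗ[R] CharacterModule I) (x : I) (m : M) :
    flipToRight φ x m = φ m x := rfl

/-- The adjunction `Hom_R(M, I⋆) ≃ Hom_{Rᵐᵒᵖ}(I, M⋆)`, from right to left. -/
def flipToLeft (φ : I →ₗ[Rᵐᵒᵖ] CharacterModule M) : M →ₗ[R] CharacterModule I where
  toFun m := (AddMonoidHom.mk' (fun x ↦ φ x m) fun a b ↦ by rw [map_add]; rfl :
    I →+ AddCircle (1 : ℚ))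
  map_add' m n := by
    ext x
    exact map_add (φ x) m n
  map_smul' r m := by
    ext x
    exact (DFunLike.congr_fun (φ.map_smul (op r) x) m).symm

/-- The evaluation `M → M⋆⋆`. -/
def eval (R : Type*) [Ring R] (M : Type*) [AddCommGroup M] [Module R M] :
    M →ₗ[R] CharacterModule (CharacterModule M) :=
  flipToLeft LinearMap.id

lemma eval_injective : Function.Injective (eval R M) := by
  rw [injective_iff_map_eq_zero]
  exact fun m hm ↦ eq_zero_of_character_apply fun c ↦ DFunLike.congr_fun hm c

end CharacterModule

open CharacterModule

namespace BalancedTensor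

/-- The pure tensor `x ⊗ m`. -/
def tmul (R : Type*) [Ring R] {I : Type*} [AddCommGroup I] [Module Rᵐᵒᵖ I]
    {M : Type*} [AddCommGroup M] [Module R M] (x : I) (m : M) : BalancedTensor R I M :=
  QuotientAddGroup.mk (x ⊗ₜ[ℤ] m)

lemma hom_ext {X : Type*} [AddCommGroup X] {c d : BalancedTensor R I M →+ X}
    (h : ∀ x m, c (tmul R x m) = d (tmul R x m)) : c = d := by
  refine DFunLike.ext _ _ fun t ↦ ?_
  obtain ⟨t, rfl⟩ := QuotientAddGroup.mk_surjective t
  induction t with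
  | zero => exact (map_zero c).trans (map_zero d).symm
  | tmul x m => exact h x m
  | add s t hs ht =>
    rw [QuotientAddGroup.mk_add, map_add, map_add, hs, ht]

/-- A linear map `M → I⋆` induces a character of `I ⊗_R M`. -/
noncomputable def uncurry (φ : M →ₗ[R] CharacterModule I) :
    BalancedTensor R I M →+ AddCircle (1 : ℚ) :=
  QuotientAddGroup.lift (balancedRel R I M)
    (TensorProduct.liftAddHom (flipToRight φ).toAddMonoidHom fun r x m ↦ by
      change flipToRight φ (r • x) m = flipToRight φ x (r • m)
      rw [flipToRight_apply, flipToRight_apply, map_zsmul, map_zsmul]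
      rfl) (by
      rw [balancedRel, AddSubgroup.closure_le]
      rintro _ ⟨x, r, m, rfl⟩
      rw [SetLike.mem_coe, AddMonoidHom.mem_ker, map_sub, sub_eq_zero]
      change φ m (op r • x) = φ (r • m) x
      exact (DFunLike.congr_fun (φ.map_smul r m) x).symm)

/-- A character of `I ⊗_R M` induces a linear map `M → I⋆`. -/
def curry (c : BalancedTensor R I M →+ AddCircle (1 : ℚ)) : M →ₗ[R] CharacterModule I where
  toFun m := (AddMonoidHom.mk' (fun x ↦ c (tmul R x m)) fun a b ↦ by
    rw [← map_add]
    exact congrArg c (congrArg _ (TensorProduct.add_tmul a b m)) : I →+ AddCircle (1 : ℚ))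
  map_add' m n := by
    ext x
    change c _ = c _ + c _
    rw [← map_add]
    exact congrArg c (congrArg _ (TensorProduct.tmul_add x m n))
  map_smul' r m := by
    ext x
    change c (tmul R x (r • m)) = c (tmul R (op r • x) m)
    refine congrArg c (Eq.symm ((QuotientAddGroup.eq_iff_sub_mem).2 ?_))
    exact AddSubgroup.subset_closure ⟨x, r, m, rfl⟩

/-- `I ⊗_R -` keeps a complex `M₁ → M₂ → M₃` exact if and only if `Hom_R(-, I⋆)` does. -/
lemma exact_map_iff {M₁ M₂ M₃ : Type*} [AddCommGroup M₁] [Module R M₁] [AddCommGroup M₂]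
    [Module R M₂] [AddCommGroup M₃] [Module R M₃] (f : M₁ →ₗ[R] M₂) (g : M₂ →ₗ[R] M₃)
    (hgf : g ∘ₗ f = 0) :
    Function.Exact (BalancedTensor.map (LinearMap.id : I →ₗ[Rᵐᵒᵖ] I) f)
      (BalancedTensor.map (LinearMap.id : I →ₗ[Rᵐᵒᵖ] I) g) ↔
    ∀ φ : M₂ →ₗ[R] CharacterModule I, φ ∘ₗ f = 0 → ∃ ψ : M₃ →ₗ[R] CharacterModule I,
      ψ ∘ₗ g = φ := by
  constructor
  · intro h φ hφ
    obtain ⟨c, hc⟩ := exists_comp_eq_of_ker_le (BalancedTensor.map LinearMap.id g) (uncurry φ) (by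
      intro t ht
      obtain ⟨s, rfl⟩ := (h t).1 ht
      have : (uncurry φ).comp (BalancedTensor.map LinearMap.id f) = 0 := by
        refine hom_ext fun x m ↦ ?_
        change φ (f m) x = 0
        rw [← LinearMap.comp_apply, hφ]
        rfl
      exact DFunLike.congr_fun this s)
    refine ⟨curry c, ?_⟩
    ext m x
    exact hc (tmul R x m)
  · intro h t
    constructor
    · intro ht
      by_contra hmem
      obtain ⟨c, hc, hct⟩ := exists_apply_ne_zero_of_notMem
        (BalancedTensor.map (LinearMap.id : I →ₗ[Rᵐᵒᵖ] I) f).range (x := t) hmem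
      obtain ⟨ψ, hψ⟩ := h (curry c) (by
        ext m x
        exact hc _ ⟨tmul R x m, rfl⟩)
      have key : c = (uncurry ψ).comp (BalancedTensor.map LinearMap.id g) :=
        hom_ext fun x m ↦ (DFunLike.congr_fun (LinearMap.congr_fun hψ m) x).symm
      apply hct
      rw [key, AddMonoidHom.comp_apply, ht, map_zero]
    · rintro ⟨s, rfl⟩
      have : (BalancedTensor.map (LinearMap.id : I →ₗ[Rᵐᵒᵖ] I) g).comp
          (BalancedTensor.map LinearMap.id f) = 0 := by
        refine hom_ext fun x m ↦ ?_
        change tmul R x (g (f m)) = 0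
        rw [← LinearMap.comp_apply, hgf]
        exact congrArg QuotientAddGroup.mk (TensorProduct.tmul_zero _ x)
      exact DFunLike.congr_fun this s

end BalancedTensor

end Duality

section Flat

open CharacterModule BalancedTensor

variable {R : Type u} [Ring R]

/-- Lambek's criterion: flatness is injectivity of the character module. -/
lemma isFlatLeft_iff_injective (M : Type u) [AddCommGroup M] [Module R M] :
    IsFlatLeft R M ↔ Module.Injective Rᵐᵒᵖ (CharacterModule M) := by
  constructor
  · refine fun h ↦ ⟨fun A B _ _ _ _ g hg φ ↦ ?_⟩
    have hinj := h A B g hg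
    obtain ⟨c, hc⟩ := exists_comp_eq_of_ker_le
      (BalancedTensor.map g (LinearMap.id : M →ₗ[R] M)) (uncurry (flipToLeft φ)) (by
        intro t ht
        rw [(injective_iff_map_eq_zero _).1 hinj t ht, map_zero])
    refine ⟨flipToRight (curry c), fun x ↦ ?_⟩
    ext m
    exact hc (tmul R x m)
  · intro h A B _ _ _ _ g hg
    rw [injective_iff_map_eq_zero]
    intro t ht
    refine eq_zero_of_character_apply fun c ↦ ?_
    obtain ⟨ψ, hψ⟩ := h.out g hg (flipToRight (curry c))
    have key : c = (uncurry (flipToLeft ψ)).comp (BalancedTensor.map g LinearMap.id) :=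
      hom_ext fun x m ↦ (DFunLike.congr_fun (hψ x) m).symm
    rw [key]
    exact (congrArg _ ht).trans (map_zero _)

end Flat

/-! ### Injective modules -/

section Injective

variable {S : Type*} [Ring S]

lemma Module.Injective.of_retract {Q Q' : Type u} [AddCommGroup Q] [Module S Q] [AddCommGroup Q']
    [Module S Q'] (h : Module.Injective S Q) (i : Q' →ₗ[S] Q) (r : Q →ₗ[S] Q')
    (hri : ∀ x, r (i x) = x) : Module.Injective S Q' where
  out X Y _ _ _ _ f hf g := by
    obtain ⟨k, hk⟩ := h.out f hf (i ∘ₗ g)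
    exact ⟨r ∘ₗ k, fun x ↦ by
      rw [LinearMap.comp_apply, hk, LinearMap.comp_apply, hri]⟩

/-- Injective modules are closed under extensions. -/
lemma Module.Injective.of_isShortExact {X Y Z : Type u} [AddCommGroup X] [Module S X]
    [AddCommGroup Y] [Module S Y] [AddCommGroup Z] [Module S Z] (hX : Module.Injective S X)
    (hZ : Module.Injective S Z) {f : X →ₗ[S] Y} {g : Y →ₗ[S] Z} (h : IsShortExact f g) :
    Module.Injective S Y where
  out A B _ _ _ _ i hi φ := by
    obtain ⟨r, hr⟩ := hX.out f h.injective LinearMap.id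
    obtain ⟨a, ha⟩ := hX.out i hi (r ∘ₗ φ)
    obtain ⟨b, hb⟩ := hZ.out i hi (g ∘ₗ φ)
    -- `y - f (r y)` only depends on `g y`, which gives a section `s` of `g` with `r ∘ s = 0`
    obtain ⟨s, hs⟩ := h.exists_desc (LinearMap.id - f ∘ₗ r) fun x ↦ by simp [hr]
    refine ⟨f ∘ₗ a + s ∘ₗ b, fun x ↦ ?_⟩
    simp [ha, hb, hs]

end Injective

/-! ### Coherence and flatness of character modules -/

section Coherent

open CharacterModule

variable {R : Type u} [Ring R]

/-- Over a right coherent ring, the right relations among finitely many elements are finitely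
generated. -/
lemma IsRightCoherent.exists_relations (hR : IsRightCoherent R) {ι : Type} [Fintype ι]
    (a : ι → R) : ∃ (m : ℕ) (b : Fin m → ι → R), (∀ j, ∑ i, a i * b j i = 0) ∧
      ∀ c : ι → R, ∑ i, a i * c i = 0 → ∃ r : Fin m → R, ∀ i, c i = ∑ j, b j i * r j := by
  let J : Submodule Rᵐᵒᵖ R := Submodule.span Rᵐᵒᵖ (Set.range a)
  have hJ : J.FG := Submodule.fg_span (Set.finite_range a)
  have := hR J hJ
  let p : (ι → Rᵐᵒᵖ) →ₗ[Rᵐᵒᵖ] J := Fintype.linearCombination Rᵐᵒᵖ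
    fun i ↦ (⟨a i, Submodule.subset_span ⟨i, rfl⟩⟩ : J)
  have hpc : ∀ c, (p c : R) = ∑ i, a i * (c i).unop := by
    intro c
    simp [p, Fintype.linearCombination_apply]
  have hp : Function.Surjective p := by
    rintro ⟨x, hx⟩
    obtain ⟨c, hc⟩ := (Submodule.mem_span_range_iff_exists_fun Rᵐᵒᵖ).1 hx
    refine ⟨c, Subtype.ext ?_⟩
    exact (hpc c).trans hc
  obtain ⟨m, b, hb⟩ := Submodule.fg_iff_exists_fin_generating_family.1
    (Module.FinitePresentation.fg_ker p hp)
  refine ⟨m, fun j i ↦ (b j i).unop, fun j ↦ ?_, fun c hc ↦ ?_⟩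
  · have : p (b j) = 0 := by
      rw [← LinearMap.mem_ker, ← hb]
      exact Submodule.subset_span ⟨j, rfl⟩
    rw [← hpc, this]
    rfl
  · have hmem : (fun i ↦ op (c i)) ∈ Submodule.span Rᵐᵒᵖ (Set.range b) := by
      rw [hb, LinearMap.mem_ker]
      apply Subtype.ext
      rw [hpc]
      exact hc
    obtain ⟨r, hr⟩ := (Submodule.mem_span_range_iff_exists_fun Rᵐᵒᵖ).1 hmem
    refine ⟨fun j ↦ (r j).unop, fun i ↦ MulOpposite.op_injective ?_⟩
    rw [← congrFun hr i]
    simp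

/-- An equational criterion for flatness: by Baer's criterion it suffices that every relation
`∑ aᵢ • xᵢ = 0` is respected by all right linear maps from a right ideal containing the `aᵢ`. -/
lemma isFlatLeft_of_relations {M : Type u} [AddCommGroup M] [Module R M]
    (h : ∀ (J : Ideal Rᵐᵒᵖ) (φ : J →ₗ[Rᵐᵒᵖ] CharacterModule M) (n : ℕ) (a : Fin n → J)
      (x : Fin n → M), ∑ i, (a i : Rᵐᵒᵖ).unop • x i = 0 → ∑ i, φ (a i) (x i) = 0) :
    IsFlatLeft R M := by
  rw [isFlatLeft_iff_injective]
  refine Module.Baer.injective fun J φ ↦ ?_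
  obtain ⟨c, hc⟩ := exists_comp_eq_of_ker_le
    (Finsupp.liftAddHom fun a : J ↦ DistribSMul.toAddMonoidHom M (a : Rᵐᵒᵖ).unop)
    (Finsupp.liftAddHom fun a : J ↦ (φ a).hom) (by
      intro t ht
      rw [Finsupp.liftAddHom_apply, Finsupp.sum, ← Finset.sum_coe_sort,
        ← t.support.equivFin.symm.sum_comp] at ht ⊢
      exact h J φ _ (fun i ↦ t.support.equivFin.symm i) (fun i ↦ t (t.support.equivFin.symm i)) ht)
  refine ⟨LinearMap.toSpanSingleton Rᵐᵒᵖ (CharacterModule M) c, fun r hr ↦ ?_⟩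
  ext m
  have := hc (Finsupp.single ⟨r, hr⟩ m)
  rw [Finsupp.liftAddHom_apply_single, Finsupp.liftAddHom_apply_single] at this
  exact this

/-- Over a right coherent ring the character module of an injective right module is flat. -/
lemma IsRightCoherent.isFlatLeft_characterModule (hR : IsRightCoherent R) {I : Type u}
    [AddCommGroup I] [Module Rᵐᵒᵖ I] (hI : Module.Injective Rᵐᵒᵖ I) :
    IsFlatLeft R (CharacterModule I) := by
  refine isFlatLeft_of_relations fun J φ n a x hx ↦ ?_
  obtain ⟨m, b, hab, hb⟩ := hR.exists_relations fun i ↦ (a i : Rᵐᵒᵖ).unop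
  -- the kernel of `T` consists of the tuples `(y · aᵢ)ᵢ`, and `∑ xᵢ` vanishes on these
  let T : (Fin n → I) →+ (Fin m → I) := AddMonoidHom.mk' (fun y j ↦ ∑ i, op (b j i) • y i) (by
    intro y z
    ext j
    simp [Finset.sum_add_distrib])
  let H : (Fin n → I) →+ AddCircle (1 : ℚ) := AddMonoidHom.mk' (fun y ↦ ∑ i, x i (y i)) (by
    intro y z
    simp [Finset.sum_add_distrib])
  obtain ⟨g, hg⟩ := exists_comp_eq_of_ker_le T H (by
    intro y hy
    let p : (Fin n → Rᵐᵒᵖ) →ₗ[Rᵐᵒᵖ] Rᵐᵒᵖ := Fintype.linearCombination Rᵐᵒᵖ fun i ↦ (a i : Rᵐᵒᵖ)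
    let q : (Fin n → Rᵐᵒᵖ) →ₗ[Rᵐᵒᵖ] I := Fintype.linearCombination Rᵐᵒᵖ y
    have hq : LinearMap.ker p ≤ LinearMap.ker q := by
      intro c hc
      have hc' : ∑ i, (a i : Rᵐᵒᵖ).unop * (c i).unop = 0 := by
        apply MulOpposite.op_injective
        simpa [p, Fintype.linearCombination_apply] using hc
      obtain ⟨r, hr⟩ := hb _ hc'
      have hr' : ∀ i, c i = ∑ j, op (r j) * op (b j i) := fun i ↦ by
        apply MulOpposite.unop_injective
        simp [hr]
      change ∑ i, c i • y i = 0
      simp_rw [hr', Finset.sum_smul, mul_smul]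
      rw [Finset.sum_comm]
      simp_rw [← Finset.smul_sum]
      refine Finset.sum_eq_zero fun j _ ↦ ?_
      have : ∑ i, op (b j i) • y i = 0 := congrFun hy j
      rw [this, smul_zero]
    obtain ⟨k, hk⟩ : ∃ k : Rᵐᵒᵖ →ₗ[Rᵐᵒᵖ] I, ∀ c, k (p c) = q c := by
      have hbaer := Module.Baer.of_injective hI
      obtain ⟨k, hk⟩ := hbaer.extension_property ((LinearMap.ker p).liftQ p le_rfl)
        (LinearMap.ker_eq_bot.1 (Submodule.ker_liftQ_eq_bot _ _ _ le_rfl))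
        ((LinearMap.ker p).liftQ q hq)
      exact ⟨k, fun c ↦ LinearMap.congr_fun hk ((LinearMap.ker p).mkQ c)⟩
    have hy' : ∀ i, y i = (a i : Rᵐᵒᵖ) • k 1 := by
      intro i
      have := hk (Pi.single i 1)
      simp only [p, q, Fintype.linearCombination_apply_single, one_smul] at this
      rw [← this, ← map_smul, smul_eq_mul, mul_one]
    have := DFunLike.congr_fun hx (k 1)
    rw [sum_apply'] at this
    change ∑ i, x i (y i) = 0
    simp_rw [hy']
    exact this)
  let G : Fin m → CharacterModule I := fun j ↦ g.comp (AddMonoidHom.single (fun _ ↦ I) j)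
  have hxG : ∀ i, x i = ∑ j, b j i • G j := by
    intro i
    ext z
    have hHz : H (Pi.single i z) = x i z := by
      change ∑ i', x i' ((Pi.single i z : Fin n → I) i') = x i z
      rw [Finset.sum_eq_single i (fun j _ hj ↦ by rw [Pi.single_eq_of_ne hj, map_zero])
        (fun hi ↦ absurd (Finset.mem_univ i) hi), Pi.single_eq_same]
    have hTz : T (Pi.single i z) = ∑ j, Pi.single j (op (b j i) • z) := by
      ext j
      rw [Finset.univ_sum_single]
      change ∑ i', op (b j i') • (Pi.single i z : Fin n → I) i' = op (b j i) • z
      rw [Finset.sum_eq_single i (fun j _ hj ↦ by rw [Pi.single_eq_of_ne hj, smul_zero])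
        (fun hi ↦ absurd (Finset.mem_univ i) hi), Pi.single_eq_same]
    rw [← hHz, ← hg, hTz, map_sum, sum_apply']
    rfl
  have hrel : ∀ j, ∑ i, op (b j i) • a i = 0 := by
    intro j
    apply Subtype.ext
    apply MulOpposite.unop_injective
    rw [AddSubmonoidClass.coe_finsetSum, Finset.unop_sum]
    exact hab j
  calc ∑ i, φ (a i) (x i) = ∑ i, ∑ j, φ (op (b j i) • a i) (G j) := by
        refine Finset.sum_congr rfl fun i _ ↦ ?_
        rw [hxG i, map_sum]
        refine Finset.sum_congr rfl fun j _ ↦ ?_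
        exact (DFunLike.congr_fun (φ.map_smul (op (b j i)) (a i)) (G j)).symm
    _ = ∑ j, φ (∑ i, op (b j i) • a i) (G j) := by
        rw [Finset.sum_comm]
        refine Finset.sum_congr rfl fun j _ ↦ ?_
        rw [map_sum, sum_apply']
    _ = 0 := by
        refine Finset.sum_eq_zero fun j _ ↦ ?_
        rw [hrel j, map_zero]
        rfl

end Coherent

/-! ### Closure properties of flat modules -/

section FlatClosure

open CharacterModule

variable {R : Type u} [Ring R]

lemma IsShortExact.dualLeft {A B C : Type*} [AddCommGroup A] [AddCommGroup B]
    [AddCommGroup C] [Module R A] [Module R B] [Module R C] {f : A →ₗ[R] B} {g : B →ₗ[R] C}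
    (h : IsShortExact f g) :
    IsShortExact (CharacterModule.dualLeft g) (CharacterModule.dualLeft f) := by
  refine ⟨fun c d hcd ↦ ?_, fun c ↦ ⟨fun hc ↦ ?_, ?_⟩, fun c ↦ ?_⟩
  · ext x
    obtain ⟨b, rfl⟩ := h.surjective x
    exact DFunLike.congr_fun hcd b
  · obtain ⟨d, hd⟩ := exists_comp_eq_of_ker_le g.toAddMonoidHom c.hom (by
      intro b hb
      obtain ⟨a, rfl⟩ := (h.exact b).1 hb
      exact DFunLike.congr_fun hc a)
    refine ⟨d, ?_⟩
    ext b
    exact hd b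
  · rintro ⟨d, rfl⟩
    ext a
    change d (g (f a)) = 0
    rw [h.apply_apply]
    exact map_zero d
  · obtain ⟨d, hd⟩ := exists_comp_eq_of_ker_le f.toAddMonoidHom c.hom (by
      intro a ha
      rw [(injective_iff_map_eq_zero f).1 h.injective a ha, map_zero])
    refine ⟨d, ?_⟩
    ext a
    exact hd a

/-- Flat modules lift against the duals of injections of right modules. -/
lemma isFlatLeft_iff_exists_lift {M : Type u} [AddCommGroup M] [Module R M] :
    IsFlatLeft R M ↔ ∀ (A B : Type u) [AddCommGroup A] [AddCommGroup B] [Module Rᵐᵒᵖ A]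
      [Module Rᵐᵒᵖ B] (g : A →ₗ[Rᵐᵒᵖ] B), Function.Injective g →
      ∀ φ : M →ₗ[R] CharacterModule A, ∃ ψ : M →ₗ[R] CharacterModule B,
        ∀ m a, ψ m (g a) = φ m a := by
  rw [isFlatLeft_iff_injective]
  constructor
  · intro h A B _ _ _ _ g hg φ
    obtain ⟨ψ, hψ⟩ := h.out g hg (flipToRight φ)
    exact ⟨flipToLeft ψ, fun m a ↦ DFunLike.congr_fun (hψ a) m⟩
  · refine fun h ↦ ⟨fun A B _ _ _ _ g hg φ ↦ ?_⟩
    obtain ⟨ψ, hψ⟩ := h A B g hg (flipToLeft φ)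
    refine ⟨flipToRight ψ, fun a ↦ ?_⟩
    ext m
    exact hψ m a

/-- The dual of an injection of right modules is surjective. -/
lemma CharacterModule.exists_dualRight_surjective {A B : Type*} [AddCommGroup A]
    [AddCommGroup B] [Module Rᵐᵒᵖ A] [Module Rᵐᵒᵖ B] (g : A →ₗ[Rᵐᵒᵖ] B)
    (hg : Function.Injective g) : ∃ p : CharacterModule B →ₗ[R] CharacterModule A,
      Function.Surjective p ∧ ∀ c a, p c a = c (g a) := by
  refine ⟨flipToLeft (flipToRight LinearMap.id ∘ₗ g), fun c ↦ ?_, fun c a ↦ rfl⟩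
  obtain ⟨d, hd⟩ := exists_comp_eq_of_ker_le g.toAddMonoidHom c.hom (by
    intro a ha
    rw [(injective_iff_map_eq_zero g).1 hg a ha, map_zero])
  refine ⟨d, ?_⟩
  ext a
  exact hd a

namespace IsFlatLeft

lemma of_projective (M : Type u) [AddCommGroup M] [Module R M] [Module.Projective R M] :
    IsFlatLeft R M := by
  rw [isFlatLeft_iff_exists_lift]
  intro A B _ _ _ _ g hg φ
  obtain ⟨p, hp, hpg⟩ := exists_dualRight_surjective g hg
  obtain ⟨ψ, hψ⟩ := Module.projective_lifting_property p φ hp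
  refine ⟨ψ, fun m a ↦ ?_⟩
  rw [← hpg, ← hψ]
  rfl

lemma dfinsupp {J : Type u} [DecidableEq J] {M : J → ModuleCat.{u} R}
    (h : ∀ j, IsFlatLeft R (M j)) : IsFlatLeft R (Π₀ j, M j) := by
  rw [isFlatLeft_iff_exists_lift]
  intro A B _ _ _ _ g hg φ
  choose ψ hψ using fun j ↦ isFlatLeft_iff_exists_lift.1 (h j) A B g hg
    (φ ∘ₗ DFinsupp.lsingle (R := R) (M := fun j ↦ M j) j)
  obtain ⟨p, -, hpg⟩ := exists_dualRight_surjective g hg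
  have key : p ∘ₗ DFinsupp.lsum ℕ ψ = φ := by
    refine DFinsupp.lhom_ext' fun j ↦ ?_
    ext m a
    rw [LinearMap.comp_apply, LinearMap.comp_apply, hpg]
    simpa using hψ j m a
  refine ⟨DFinsupp.lsum ℕ ψ, fun m a ↦ ?_⟩
  rw [← hpg, ← key]
  rfl

variable {A B C : Type u} [AddCommGroup A] [AddCommGroup B] [AddCommGroup C]
  [Module R A] [Module R B] [Module R C] {f : A →ₗ[R] B} {g : B →ₗ[R] C}

lemma of_isShortExact (h : IsShortExact f g) (hA : IsFlatLeft R A) (hC : IsFlatLeft R C) :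
    IsFlatLeft R B := by
  rw [isFlatLeft_iff_injective] at *
  exact hC.of_isShortExact hA h.dualLeft

/-- If `C` is flat, then `B⋆ → A⋆` has a section. -/
lemma exists_section (h : IsShortExact f g) (hC : IsFlatLeft R C) :
    ∃ s : CharacterModule A →ₗ[Rᵐᵒᵖ] CharacterModule B, ∀ c, dualLeft f (s c) = c := by
  rw [isFlatLeft_iff_injective] at hC
  obtain ⟨r, hr⟩ := hC.out (dualLeft g) h.dualLeft.injective LinearMap.id
  obtain ⟨s, hs⟩ := h.dualLeft.exists_desc (LinearMap.id - dualLeft g ∘ₗ r) fun c ↦ by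
    rw [LinearMap.sub_apply, LinearMap.comp_apply, hr, LinearMap.id_apply, LinearMap.id_apply,
      sub_self]
  refine ⟨s, fun c ↦ ?_⟩
  obtain ⟨b, rfl⟩ := h.dualLeft.surjective c
  rw [hs, LinearMap.sub_apply, LinearMap.comp_apply, map_sub, h.dualLeft.apply_apply, sub_zero,
    LinearMap.id_apply]

lemma of_isShortExact_left (h : IsShortExact f g) (hB : IsFlatLeft R B) (hC : IsFlatLeft R C) :
    IsFlatLeft R A := by
  obtain ⟨s, hs⟩ := exists_section h hC
  rw [isFlatLeft_iff_injective] at *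
  exact hB.of_retract s (dualLeft f) hs

lemma prod (hA : IsFlatLeft R A) (hB : IsFlatLeft R B) : IsFlatLeft R (A × B) :=
  of_isShortExact (f := LinearMap.inl R A B) (g := LinearMap.snd R A B)
    ⟨LinearMap.inl_injective, Function.Exact.inl_snd, LinearMap.snd_surjective⟩ hA hB

/-- Maps into a character module extend along an injection with flat cokernel. -/
lemma exists_extend (h : IsShortExact f g) (hC : IsFlatLeft R C) {I : Type*} [AddCommGroup I]
    [Module Rᵐᵒᵖ I] (φ : A →ₗ[R] CharacterModule I) :
    ∃ ψ : B →ₗ[R] CharacterModule I, ψ ∘ₗ f = φ := by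
  obtain ⟨s, hs⟩ := exists_section h hC
  refine ⟨flipToLeft (s ∘ₗ flipToRight φ), ?_⟩
  ext a x
  exact DFunLike.congr_fun (hs (flipToRight φ x)) a

/-- Over a right coherent ring the double dual of a flat module is flat. -/
lemma characterModule_characterModule (hR : IsRightCoherent R) (hA : IsFlatLeft R A) :
    IsFlatLeft R (CharacterModule (CharacterModule A)) :=
  hR.isFlatLeft_characterModule ((isFlatLeft_iff_injective A).1 hA)

/-- A flat module is pure in its double dual, so the quotient is flat. -/
lemma of_eval (hR : IsRightCoherent R) (hA : IsFlatLeft R A)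
    {p : CharacterModule (CharacterModule A) →ₗ[R] C} (h : IsShortExact (eval R A) p) :
    IsFlatLeft R C := by
  have hAA := characterModule_characterModule hR hA
  rw [isFlatLeft_iff_injective] at hAA ⊢
  let σ : CharacterModule A →ₗ[Rᵐᵒᵖ] CharacterModule (CharacterModule (CharacterModule A)) :=
    flipToRight LinearMap.id
  have hσ : ∀ c, dualLeft (eval R A) (σ c) = c := fun c ↦ rfl
  obtain ⟨r, hr⟩ := h.dualLeft.exists_lift (LinearMap.id - σ ∘ₗ dualLeft (eval R A)) fun c ↦ by
    rw [LinearMap.sub_apply, LinearMap.comp_apply, map_sub, hσ, LinearMap.id_apply, sub_self]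
  refine hAA.of_retract (dualLeft p) r fun c ↦ h.dualLeft.injective ?_
  rw [hr, LinearMap.sub_apply, LinearMap.comp_apply, h.dualLeft.apply_apply, map_zero, sub_zero,
    LinearMap.id_apply]

end IsFlatLeft

end FlatClosure

/-! ### Vanishing of `Ext` along short exact sequences -/

section ExtVanishing

open CategoryTheory Abelian

variable {R : Type u} [Ring R] {A B C : ModuleCat.{u} R} {f : A →ₗ[R] B} {g : B →ₗ[R] C}

namespace IsShortExact

lemma shortExact (h : IsShortExact f g) :
    (ShortComplex.mk (ModuleCat.ofHom f) (ModuleCat.ofHom g) (by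
      ext a
      exact h.apply_apply a)).ShortExact where
  exact := (ShortComplex.ShortExact.moduleCat_exact_iff_function_exact _).2 h.exact
  mono_f := (ModuleCat.mono_iff_injective _).2 h.injective
  epi_g := (ModuleCat.epi_iff_surjective _).2 h.surjective

lemma subsingleton_ext₂ (h : IsShortExact f g) (E : ModuleCat.{u} R) (n : ℕ)
    (hA : Subsingleton (Ext A E n)) (hC : Subsingleton (Ext C E n)) :
    Subsingleton (Ext B E n) := by
  refine subsingleton_of_forall_eq 0 fun x ↦ ?_
  obtain ⟨y, rfl⟩ := Ext.contravariant_sequence_exact₂ h.shortExact E x (hA.elim _ _)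
  rw [hC.elim y 0, Ext.comp_zero]

lemma subsingleton_ext₁ (h : IsShortExact f g) (E : ModuleCat.{u} R) (n : ℕ)
    (hB : Subsingleton (Ext B E n)) (hC : Subsingleton (Ext C E (n + 1))) :
    Subsingleton (Ext A E n) := by
  refine subsingleton_of_forall_eq 0 fun x ↦ ?_
  obtain ⟨y, rfl⟩ := Ext.contravariant_sequence_exact₁ h.shortExact E x (add_comm 1 n)
    (hC.elim _ _)
  rw [hB.elim y 0, Ext.comp_zero]

lemma subsingleton_ext₃ (h : IsShortExact f g) (E : ModuleCat.{u} R) (n : ℕ)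
    (hA : Subsingleton (Ext A E n)) (hB : Subsingleton (Ext B E (n + 1))) :
    Subsingleton (Ext C E (n + 1)) := by
  refine subsingleton_of_forall_eq 0 fun x ↦ ?_
  obtain ⟨y, rfl⟩ := Ext.contravariant_sequence_exact₃ h.shortExact E x (hB.elim _ _)
    (add_comm 1 n)
  rw [hA.elim y 0, Ext.comp_zero]

lemma exists_extend (h : IsShortExact f g) (E : ModuleCat.{u} R) (hC : Subsingleton (Ext C E 1))
    (φ : A →ₗ[R] E) : ∃ ψ : B →ₗ[R] E, ψ ∘ₗ f = φ := by
  obtain ⟨x, hx⟩ := Ext.contravariant_sequence_exact₁ h.shortExact E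
    (Ext.mk₀ (ModuleCat.ofHom φ)) (add_zero 1) (hC.elim _ _)
  obtain ⟨ψ, rfl⟩ := (Ext.mk₀_bijective _ _).2 x
  rw [Ext.mk₀_comp_mk₀] at hx
  have := (Ext.mk₀_bijective _ _).1 hx
  exact ⟨ψ.hom, congrArg ModuleCat.Hom.hom this⟩

lemma subsingleton_ext_one (h : IsShortExact f g) (E : ModuleCat.{u} R)
    (hB : Subsingleton (Ext B E 1)) (hE : ∀ φ : A →ₗ[R] E, ∃ ψ : B →ₗ[R] E, ψ ∘ₗ f = φ) :
    Subsingleton (Ext C E 1) := by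
  refine subsingleton_of_forall_eq 0 fun x ↦ ?_
  obtain ⟨y, rfl⟩ := Ext.contravariant_sequence_exact₃ h.shortExact E x (hB.elim _ _)
    (add_zero 1)
  obtain ⟨φ, rfl⟩ := (Ext.mk₀_bijective _ _).2 y
  obtain ⟨ψ, hψ⟩ := hE φ.hom
  have : φ = ModuleCat.ofHom f ≫ ModuleCat.ofHom ψ := by
    ext1
    exact hψ.symm
  rw [this, ← Ext.mk₀_comp_mk₀]
  exact h.shortExact.extClass_comp_assoc _

end IsShortExact

lemma subsingleton_ext_of_projective (P E : ModuleCat.{u} R) [Module.Projective R P] (n : ℕ) :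
    Subsingleton (Ext P E (n + 1)) := by
  have : Projective P := (IsProjective.iff_projective P).1 inferInstance
  exact subsingleton_of_forall_eq 0 fun x ↦ x.eq_zero_of_projective

/-- Flat modules are orthogonal to character modules, as `Tor` with them vanishes. -/
lemma IsFlatLeft.subsingleton_ext (I : Type u) [AddCommGroup I] [Module Rᵐᵒᵖ I] (n : ℕ) :
    ∀ (M : ModuleCat.{u} R), IsFlatLeft R M →
      Subsingleton (Ext M (ModuleCat.of R (CharacterModule I)) (n + 1)) := by
  induction n with
  | zero =>
    intro M hM
    obtain ⟨K, P, k, π, hP, h⟩ := IsShortExact.exists_projective_presentation M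
    exact h.subsingleton_ext_one _ (subsingleton_ext_of_projective P _ 0)
      fun φ ↦ IsFlatLeft.exists_extend h hM φ
  | succ n ih =>
    intro M hM
    obtain ⟨K, P, k, π, hP, h⟩ := IsShortExact.exists_projective_presentation M
    exact h.subsingleton_ext₃ _ _ (ih K (of_isShortExact_left h (of_projective P) hM))
      (subsingleton_ext_of_projective P _ _)

/-- Orthogonality to the character modules is inherited by direct sums. -/
lemma subsingleton_ext_dfinsupp {J : Type u} [DecidableEq J] (E : ModuleCat.{u} R) (n : ℕ) :
    ∀ (M : J → ModuleCat.{u} R), (∀ j, ∀ k, Subsingleton (Ext (M j) E (k + 1))) →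
      Subsingleton (Ext (ModuleCat.of R (Π₀ j, M j)) E (n + 1)) := by
  induction n with
  | zero =>
    intro M hM
    choose K P k π hP h using fun j ↦ IsShortExact.exists_projective_presentation (M j)
    have hP' : Module.Projective R (ModuleCat.of R (Π₀ j, P j)) :=
      inferInstanceAs (Module.Projective R (Π₀ j, P j))
    refine (IsShortExact.mapRange h).subsingleton_ext_one (A := ModuleCat.of R (Π₀ j, K j))
      (B := ModuleCat.of R (Π₀ j, P j)) (C := ModuleCat.of R (Π₀ j, M j)) E
      (subsingleton_ext_of_projective _ _ 0) fun φ ↦ ?_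
    choose ψ hψ using fun j ↦ (h j).exists_extend E (hM j 0)
      (φ ∘ₗ DFinsupp.lsingle (R := R) (M := fun j ↦ K j) j)
    refine ⟨DFinsupp.lsum ℕ ψ, DFinsupp.lhom_ext' fun j ↦ ?_⟩
    rw [← hψ]
    ext x
    simp
  | succ n ih =>
    intro M hM
    choose K P k π hP h using fun j ↦ IsShortExact.exists_projective_presentation (M j)
    have hP' : Module.Projective R (ModuleCat.of R (Π₀ j, P j)) :=
      inferInstanceAs (Module.Projective R (Π₀ j, P j))
    refine (IsShortExact.mapRange h).subsingleton_ext₃ (A := ModuleCat.of R (Π₀ j, K j))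
      (B := ModuleCat.of R (Π₀ j, P j)) (C := ModuleCat.of R (Π₀ j, M j)) E (n + 1)
      (ih K fun j k ↦ ?_) (subsingleton_ext_of_projective _ _ _)
    exact (h j).subsingleton_ext₁ E _ (subsingleton_ext_of_projective _ _ _) (hM j (k + 1))

end ExtVanishing

/-! ### Gorenstein flat modules by one-sided coresolutions -/

section GorensteinFlat

open CategoryTheory Abelian

variable {R : Type u} [Ring R]

/-- `Tor_n(I, M) = 0` for all `n ≥ 1` and all injective right modules `I`. The condition is encoded
as the vanishing of `Extⁿ(M, I⋆)`, the character module of `Tor_n(I, M)`. -/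
def IsTorOrthogonal (M : ModuleCat.{u} R) : Prop :=
  ∀ (I : Type u) [AddCommGroup I] [Module Rᵐᵒᵖ I], Module.Injective Rᵐᵒᵖ I →
    ∀ n : ℕ, Subsingleton (Ext M (ModuleCat.of R (CharacterModule I)) (n + 1))

namespace IsTorOrthogonal

variable {A B C : ModuleCat.{u} R} {f : A →ₗ[R] B} {g : B →ₗ[R] C}

lemma of_isFlatLeft (h : IsFlatLeft R A) : IsTorOrthogonal A :=
  fun I _ _ _ n ↦ h.subsingleton_ext I n A

lemma of_isShortExact (h : IsShortExact f g) (hA : IsTorOrthogonal A) (hC : IsTorOrthogonal C) :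
    IsTorOrthogonal B :=
  fun I _ _ hI n ↦ h.subsingleton_ext₂ _ _ (hA I hI n) (hC I hI n)

lemma of_isShortExact_left (h : IsShortExact f g) (hB : IsTorOrthogonal B)
    (hC : IsTorOrthogonal C) : IsTorOrthogonal A :=
  fun I _ _ hI n ↦ h.subsingleton_ext₁ _ _ (hB I hI n) (hC I hI (n + 1))

lemma dfinsupp {J : Type u} [DecidableEq J] {M : J → ModuleCat.{u} R}
    (h : ∀ j, IsTorOrthogonal (M j)) : IsTorOrthogonal (ModuleCat.of R (Π₀ j, M j)) :=
  fun I _ _ hI n ↦ subsingleton_ext_dfinsupp _ n M fun j ↦ h j I hI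

lemma of_equiv (e : A ≃ₗ[R] B) (hA : IsTorOrthogonal A) : IsTorOrthogonal B :=
  of_isShortExact (C := ModuleCat.of R PUnit) (f := e.toLinearMap) (g := 0)
    ⟨e.injective, fun b ↦ ⟨fun _ ↦ e.surjective b, fun _ ↦ rfl⟩, fun _ ↦ ⟨0, rfl⟩⟩ hA
    (of_isFlatLeft (IsFlatLeft.of_projective PUnit))

end IsTorOrthogonal

/-- A class of modules orthogonal to the injective right modules, each of which embeds in a flat
module with cokernel in the class. The Gorenstein flat modules form the largest such class. -/
def IsCoresolvedClass (𝒞 : ModuleCat.{u} R → Prop) : Prop :=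
  ∀ M, 𝒞 M → IsTorOrthogonal M ∧ ∃ (F L : ModuleCat.{u} R) (i : M →ₗ[R] F) (p : F →ₗ[R] L),
    IsFlatLeft R F ∧ IsShortExact i p ∧ 𝒞 L

/-- A relation in which every point has a successor and a predecessor has doubly infinite chains
through every point. -/
lemma exists_int_chain {α : Type*} (r : α → α → Prop) (hs : ∀ x, ∃ y, r x y)
    (hp : ∀ x, ∃ y, r y x) (k : ℤ) (x : α) : ∃ s : ℤ → α, s k = x ∧ ∀ i, r (s i) (s (i + 1)) := by
  choose u hu using hs
  choose v hv using hp
  let s : ℤ → α := fun i ↦ match i with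
    | Int.ofNat n => u^[n] x
    | Int.negSucc n => v^[n + 1] x
  have h : ∀ i, r (s i) (s (i + 1)) := by
    rintro (n | n)
    · change r (u^[n] x) (u^[n + 1] x)
      rw [Function.iterate_succ_apply']
      exact hu _
    · cases n with
      | zero => exact hv x
      | succ n =>
        change r (v^[n + 2] x) (v^[n + 1] x)
        rw [Function.iterate_succ_apply' v (n + 1)]
        exact hv _
  refine ⟨fun i ↦ s (i - k), ?_, fun i ↦ ?_⟩
  · change s (k - k) = x
    rw [sub_self]
    rfl
  · change r (s (i - k)) (s (i + 1 - k))
    rw [add_sub_right_comm]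
    exact h _

lemma isCoresolvedClass_isGorensteinFlat :
    IsCoresolvedClass fun M : ModuleCat.{u} R ↦ IsGorensteinFlat R M := by
  rintro M ⟨F, d, hF, hd, hI, ⟨e⟩⟩
  have hse : ∀ j, IsShortExact (LinearMap.range (d j)).subtype (d (j + 1)).rangeRestrict :=
    fun j ↦ ⟨Subtype.val_injective, fun x ↦ by
      rw [Subtype.ext_iff]
      change d (j + 1) x = 0 ↔ _
      rw [hd j x]
      simp, LinearMap.surjective_rangeRestrict _⟩
  constructor
  · refine IsTorOrthogonal.of_equiv (A := ModuleCat.of R (LinearMap.range (d 0))) e.symm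
      fun I _ _ hinj n ↦ ?_
    generalize (0 : ℤ) = j
    induction n generalizing j with
    | zero =>
      obtain ⟨i, rfl⟩ : ∃ i, j = i + 1 + 1 := ⟨j - 2, by ring⟩
      refine (hse (i + 1)).subsingleton_ext_one (A := ModuleCat.of R (LinearMap.range (d (i + 1))))
        (C := ModuleCat.of R (LinearMap.range (d (i + 1 + 1)))) _
        ((hF _).subsingleton_ext I 0 _) fun φ ↦ ?_
      have hdd : d (i + 1) ∘ₗ d i = 0 := LinearMap.ext fun x ↦ (hd i).apply_apply_eq_zero x
      obtain ⟨ψ, hψ⟩ := (BalancedTensor.exact_map_iff _ _ hdd).1 (hI I hinj i)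
        (φ ∘ₗ (d (i + 1)).rangeRestrict) (by
          ext1 x
          have : (d (i + 1)).rangeRestrict (d i x) = 0 := Subtype.ext (LinearMap.congr_fun hdd x)
          rw [LinearMap.comp_apply, LinearMap.comp_apply, this, map_zero, LinearMap.zero_apply])
      refine ⟨ψ, ?_⟩
      ext1 ⟨_, x, rfl⟩
      exact LinearMap.congr_fun hψ x
    | succ n ih =>
      obtain ⟨i, rfl⟩ : ∃ i, j = i + 1 := ⟨j - 1, by ring⟩
      exact (hse i).subsingleton_ext₃ (A := ModuleCat.of R (LinearMap.range (d i)))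
        (C := ModuleCat.of R (LinearMap.range (d (i + 1)))) _ (n + 1) (ih i)
        ((hF _).subsingleton_ext I _ _)
  · refine ⟨F (0 + 1), ModuleCat.of R (LinearMap.range (d (0 + 1))),
      (LinearMap.range (d 0)).subtype ∘ₗ e.toLinearMap, (d (0 + 1)).rangeRestrict, hF _,
      ⟨(hse 0).injective.comp e.injective, fun x ↦ ((hse 0).exact x).trans ?_,
        (hse 0).surjective⟩, ?_⟩
    · exact ⟨fun ⟨y, hy⟩ ↦ ⟨e.symm y, by simpa using hy⟩, fun ⟨y, hy⟩ ↦ ⟨e y, hy⟩⟩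
    · exact ⟨fun i ↦ F (i + 1), fun i ↦ d (i + 1), fun i ↦ hF _, fun i ↦ hd _,
        fun I _ _ hinj i ↦ hI I hinj _, ⟨LinearEquiv.refl R _⟩⟩

/-- The members of a coresolved class are Gorenstein flat: a projective resolution is spliced with
the coresolution, and exactness under `I ⊗_R -` follows from orthogonality. -/
lemma IsCoresolvedClass.isGorensteinFlat {𝒞 : ModuleCat.{u} R → Prop} (h : IsCoresolvedClass 𝒞)
    {M : ModuleCat.{u} R} (hM : 𝒞 M) : IsGorensteinFlat R M := by
  -- The union of all coresolved classes: a coresolved class stays so when the kernel of a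
  -- surjection from a projective module to a member is added, so members of the union have predecessors.
  let 𝒟 : ModuleCat.{u} R → Prop := fun X ↦
    ∃ 𝒞 : ModuleCat.{u} R → Prop, IsCoresolvedClass 𝒞 ∧ 𝒞 X
  let r : {X // 𝒟 X} → {X // 𝒟 X} → Prop := fun X Y ↦ ∃ (F : ModuleCat.{u} R)
    (i : X.1 →ₗ[R] F) (p : F →ₗ[R] Y.1), IsFlatLeft R F ∧ IsShortExact i p
  have hs : ∀ X, ∃ Y, r X Y := by
    rintro ⟨X, 𝒞, h, hX⟩
    obtain ⟨-, F, L, i, p, hF, hip, hL⟩ := h X hX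
    exact ⟨⟨L, 𝒞, h, hL⟩, F, i, p, hF, hip⟩
  have hp : ∀ X, ∃ Y, r Y X := by
    rintro ⟨X, 𝒞, h, hX⟩
    obtain ⟨K, P, k, π, hP, hkπ⟩ := IsShortExact.exists_projective_presentation X
    have hPflat : IsFlatLeft R P := .of_projective P
    refine ⟨⟨K, fun Y ↦ Y = K ∨ 𝒞 Y, ?_, Or.inl rfl⟩, P, k, π, hPflat, hkπ⟩
    rintro Y (rfl | hY)
    · exact ⟨.of_isShortExact_left hkπ (.of_isFlatLeft hPflat) (h X hX).1, P, X, k, π, hPflat, hkπ,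
        Or.inr hX⟩
    · obtain ⟨hY', F, L, i, p, hF, hip, hL⟩ := h Y hY
      exact ⟨hY', F, L, i, p, hF, hip, Or.inr hL⟩
  obtain ⟨X, hX, hr⟩ := exists_int_chain r hs hp 1 ⟨M, 𝒞, h, hM⟩
  choose F ι π hF hιπ using hr
  have horth : ∀ i, IsTorOrthogonal (X i).1 := fun i ↦ by
    obtain ⟨𝒞', h', hX'⟩ := (X i).2
    exact (h' _ hX').1
  have hexact : ∀ i, Function.Exact (ι (i + 1) ∘ₗ π i) (ι (i + 1 + 1) ∘ₗ π (i + 1)) := by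
    intro i x
    rw [LinearMap.comp_apply, map_eq_zero_iff _ (hιπ _).injective, (hιπ (i + 1)).exact x]
    constructor
    · rintro ⟨y, rfl⟩
      obtain ⟨z, rfl⟩ := (hιπ i).surjective y
      exact ⟨z, rfl⟩
    · rintro ⟨z, rfl⟩
      exact ⟨π i z, rfl⟩
  refine ⟨F, fun i ↦ ι (i + 1) ∘ₗ π i, hF, hexact, fun I _ _ hI i ↦ ?_, ?_⟩
  · rw [BalancedTensor.exact_map_iff _ _
      (LinearMap.ext fun x ↦ (hexact i).apply_apply_eq_zero x)]
    intro φ hφ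
    obtain ⟨ψ, hψ⟩ := (hιπ (i + 1)).exists_desc φ fun y ↦ by
      obtain ⟨z, rfl⟩ := (hιπ i).surjective y
      exact LinearMap.congr_fun hφ z
    obtain ⟨χ, hχ⟩ := (hιπ (i + 1 + 1)).exists_extend _ (horth (i + 1 + 1 + 1) I hI 0) ψ
    refine ⟨χ, ?_⟩
    ext1 x
    exact (LinearMap.congr_fun hχ _).trans (hψ x)
  · have h1 : Nonempty (M ≃ₗ[R] (X (0 + 1)).1) := by
      rw [zero_add, hX]
      exact ⟨LinearEquiv.refl R M⟩
    obtain ⟨e⟩ := h1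
    refine ⟨e ≪≫ₗ LinearEquiv.ofInjective _ (hιπ (0 + 1)).injective ≪≫ₗ LinearEquiv.ofEq _ _ ?_⟩
    exact (LinearMap.range_comp_of_range_eq_top _
      (LinearMap.range_eq_top.2 (hιπ 0).surjective)).symm

namespace IsGorensteinFlat

variable {A B C F : ModuleCat.{u} R} {f : A →ₗ[R] B} {g : B →ₗ[R] C}

lemma isTorOrthogonal (h : IsGorensteinFlat R A) : IsTorOrthogonal A :=
  (isCoresolvedClass_isGorensteinFlat A h).1

lemma exists_coresolution (h : IsGorensteinFlat R A) : ∃ (F L : ModuleCat.{u} R) (i : A →ₗ[R] F)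
    (p : F →ₗ[R] L), IsFlatLeft R F ∧ IsShortExact i p ∧ IsGorensteinFlat R L :=
  (isCoresolvedClass_isGorensteinFlat A h).2

lemma of_coresolution (hA : IsTorOrthogonal A) (h : IsShortExact f g) (hB : IsFlatLeft R B)
    (hC : IsGorensteinFlat R C) : IsGorensteinFlat R A := by
  refine IsCoresolvedClass.isGorensteinFlat
    (𝒞 := fun Y : ModuleCat.{u} R ↦ Y = A ∨ IsGorensteinFlat R Y) ?_ (Or.inl rfl)
  rintro Y (rfl | hY)
  · exact ⟨hA, B, C, f, g, hB, h, Or.inr hC⟩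
  · obtain ⟨F, L, i, p, hF, hip, hL⟩ := hY.exists_coresolution
    exact ⟨hY.isTorOrthogonal, F, L, i, p, hF, hip, Or.inr hL⟩

lemma of_isFlatLeft (h : IsFlatLeft R A) : IsGorensteinFlat R A := by
  refine IsCoresolvedClass.isGorensteinFlat (𝒞 := fun Y : ModuleCat.{u} R ↦ IsFlatLeft R Y) ?_ h
  exact fun Y hY ↦ ⟨.of_isFlatLeft hY, Y, ModuleCat.of R PUnit, LinearMap.id, 0, hY,
    ⟨Function.injective_id, fun y ↦ ⟨fun _ ↦ ⟨y, rfl⟩, fun _ ↦ rfl⟩, fun _ ↦ ⟨0, rfl⟩⟩,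
    IsFlatLeft.of_projective PUnit⟩

lemma of_isShortExact_of_isFlatLeft (h : IsShortExact f g) (hA : IsGorensteinFlat R A)
    (hC : IsFlatLeft R C) : IsGorensteinFlat R B := by
  obtain ⟨F, L, i, p, hF, hip, hL⟩ := hA.exists_coresolution
  obtain ⟨P, j, q, k, r, hjq, hkr⟩ := h.exists_pushout hip
  exact of_coresolution (.of_isShortExact h hA.isTorOrthogonal (.of_isFlatLeft hC)) hkr
    (.of_isShortExact hjq hF hC) hL

/-- Over a right coherent ring, the flat module in a coresolution can be taken to be the character
module of an injective right module. -/
lemma exists_coresolution_characterModule (hR : IsRightCoherent R) (hA : IsGorensteinFlat R A) :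
    ∃ (I : Type u) (_ : AddCommGroup I) (_ : Module Rᵐᵒᵖ I) (L : ModuleCat.{u} R)
      (i : A →ₗ[R] CharacterModule I) (p : CharacterModule I →ₗ[R] L),
      Module.Injective Rᵐᵒᵖ I ∧ IsShortExact i p ∧ IsGorensteinFlat R L := by
  obtain ⟨F, L, i, p, hF, hip, hL⟩ := hA.exists_coresolution
  have h := IsShortExact.of_injective (CharacterModule.eval_injective (R := R) (M := F))
  obtain ⟨Q, q, j, r, hq, hj⟩ := hip.exists_third_iso
    (F := ModuleCat.of R (CharacterModule (CharacterModule F)))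
    (D := ModuleCat.of R (CharacterModule (CharacterModule F) ⧸ _)) h
  exact ⟨CharacterModule F, _, _, Q, _, q, (isFlatLeft_iff_injective F).1 hF, hq,
    of_isShortExact_of_isFlatLeft hj hL (.of_eval hR hF h)⟩

/-- Over a right coherent ring, Gorenstein flat modules are closed under extensions. -/
lemma of_isShortExact (hR : IsRightCoherent R) (h : IsShortExact f g) (hA : IsGorensteinFlat R A)
    (hC : IsGorensteinFlat R C) : IsGorensteinFlat R B := by
  let 𝒞 : ModuleCat.{u} R → Prop := fun B ↦ ∃ (A C : ModuleCat.{u} R) (f : A →ₗ[R] B)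
    (g : B →ₗ[R] C), IsShortExact f g ∧ IsGorensteinFlat R A ∧ IsGorensteinFlat R C
  refine IsCoresolvedClass.isGorensteinFlat (𝒞 := 𝒞) ?_ ⟨A, C, f, g, h, hA, hC⟩
  rintro B ⟨A, C, f, g, h, hA, hC⟩
  refine ⟨.of_isShortExact h hA.isTorOrthogonal hC.isTorOrthogonal, ?_⟩
  obtain ⟨I, _, _, L, i, p, hI, hip, hL⟩ := hA.exists_coresolution_characterModule hR
  obtain ⟨F', L', i', p', hF', hip', hL'⟩ := hC.exists_coresolution
  obtain ⟨k, hk⟩ := h.exists_extend _ (hC.isTorOrthogonal I hI 0) i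
  obtain ⟨Q, l, q, s, t, hlq, hst⟩ := h.exists_cohorseshoe
    (E := ModuleCat.of R (CharacterModule I)) hip hip' k (LinearMap.congr_fun hk)
  exact ⟨ModuleCat.of R (CharacterModule I × F'), Q, l, q,
    .prod (hR.isFlatLeft_characterModule hI) hF', hlq, L, L', s, t, hst, hL, hL'⟩

/-- Over a right coherent ring, Gorenstein flat modules are closed under kernels of surjections. -/
lemma of_isShortExact_left (hR : IsRightCoherent R) (h : IsShortExact f g)
    (hB : IsGorensteinFlat R B) (hC : IsGorensteinFlat R C) : IsGorensteinFlat R A := by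
  obtain ⟨F, L, i, p, hF, hip, hL⟩ := hB.exists_coresolution
  obtain ⟨Q, q, j, r, hq, hj⟩ := h.exists_third_iso hip
  exact of_coresolution (.of_isShortExact_left h hB.isTorOrthogonal hC.isTorOrthogonal) hq hF
    (of_isShortExact hR hj hC hL)

lemma dfinsupp {J : Type u} [DecidableEq J] {M : J → ModuleCat.{u} R}
    (h : ∀ j, IsGorensteinFlat R (M j)) : IsGorensteinFlat R (Π₀ j, M j) := by
  let 𝒞 : ModuleCat.{u} R → Prop := fun X ↦ ∃ M : J → ModuleCat.{u} R,
    (∀ j, IsGorensteinFlat R (M j)) ∧ X = ModuleCat.of R (Π₀ j, M j)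
  refine IsCoresolvedClass.isGorensteinFlat (𝒞 := 𝒞) ?_ (M := ModuleCat.of R (Π₀ j, M j))
    ⟨M, h, rfl⟩
  rintro _ ⟨M, h, rfl⟩
  choose F L i p hF hip hL using fun j ↦ (h j).exists_coresolution
  exact ⟨.dfinsupp fun j ↦ (h j).isTorOrthogonal, ModuleCat.of R (Π₀ j, F j),
    ModuleCat.of R (Π₀ j, L j), _, _, .dfinsupp hF, .mapRange hip, L, hL, rfl⟩

end IsGorensteinFlat

end GorensteinFlat

/-! ### Modules of bounded Gorenstein flat dimension -/

section Dimension

variable {R : Type u} [Ring R]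

/-- `Gfd_R(M) ≤ n`, by recursion on `n`: `M` is Gorenstein flat if `n = 0`, and a quotient of a
Gorenstein flat module by a submodule of dimension at most `n - 1` otherwise. -/
def GorensteinFlatDimLE : ℕ → ModuleCat.{u} R → Prop
  | 0, M => IsGorensteinFlat R M
  | n + 1, M => ∃ (K G : ModuleCat.{u} R) (k : K →ₗ[R] G) (p : G →ₗ[R] M),
      IsGorensteinFlat R G ∧ IsShortExact k p ∧ GorensteinFlatDimLE n K

lemma IsGorensteinFlat.of_equiv {M M' : Type u} [AddCommGroup M] [Module R M] [AddCommGroup M']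
    [Module R M'] (e : M ≃ₗ[R] M') (h : IsGorensteinFlat R M) : IsGorensteinFlat R M' := by
  obtain ⟨F, d, hF, hd, hI, ⟨e'⟩⟩ := h
  exact ⟨F, d, hF, hd, hI, ⟨e.symm ≪≫ₗ e'⟩⟩

lemma IsGorensteinFlat.of_subsingleton (M : Type u) [AddCommGroup M] [Module R M]
    [Subsingleton M] : IsGorensteinFlat R M :=
  IsGorensteinFlat.of_isFlatLeft (A := ModuleCat.of R M) (IsFlatLeft.of_projective M)

lemma hasGorensteinFlatResolution_iff {n : ℕ} {M : ModuleCat.{u} R} :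
    HasGorensteinFlatResolution R M n ↔ GorensteinFlatDimLE n M := by
  constructor
  · intro h
    induction n generalizing M with
    | zero =>
      obtain ⟨G, d, ε, hG, hG', hε, hdε, -⟩ := h
      have := hG' 1 Nat.one_pos
      refine (hG 0).of_equiv (LinearEquiv.ofBijective ε ⟨?_, hε⟩)
      rw [injective_iff_map_eq_zero]
      intro x hx
      obtain ⟨y, rfl⟩ := (hdε x).1 hx
      rw [Subsingleton.elim y 0, map_zero]
    | succ n ih =>
      obtain ⟨G, d, ε, hG, hG', hε, hdε, hd⟩ := h
      have hK := IsShortExact.of_surjective hε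
      refine ⟨ModuleCat.of R (LinearMap.ker ε), G 0, _, ε, hG 0, hK, ih ?_⟩
      obtain ⟨ε', hε'⟩ := hK.exists_lift (d 0) fun x ↦ hdε.apply_apply_eq_zero x
      refine ⟨fun i ↦ G (i + 1), fun i ↦ d (i + 1), ε', fun i ↦ hG _,
        fun i hi ↦ hG' _ (Nat.succ_lt_succ hi), fun x ↦ ?_, fun x ↦ ?_, fun i ↦ hd _⟩
      · obtain ⟨y, hy⟩ := (hdε x).1 x.2
        exact ⟨y, hK.injective ((hε' y).trans hy)⟩
      · rw [← hd 0 x, ← map_eq_zero_iff _ hK.injective, hε']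
  · intro h
    induction n generalizing M with
    | zero =>
      refine ⟨fun i ↦ Nat.casesOn i M fun _ ↦ ModuleCat.of R PUnit, fun _ ↦ 0, LinearMap.id,
        ?_, ?_, Function.surjective_id, fun x ↦ ?_, fun i x ↦ ?_⟩
      · rintro (_ | i)
        · exact h
        · exact .of_subsingleton PUnit
      · rintro (_ | i) hi
        · exact absurd hi (lt_irrefl 0)
        · exact inferInstanceAs (Subsingleton PUnit)
      · exact ⟨fun hx ↦ ⟨0, hx.symm⟩, fun ⟨_, hy⟩ ↦ hy.symm⟩
      · exact ⟨fun _ ↦ ⟨0, rfl⟩, fun _ ↦ rfl⟩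
    | succ n ih =>
      obtain ⟨K, G₀, k, p, hG₀, hkp, hK⟩ := h
      obtain ⟨G, d, ε, hG, hG', hε, hdε, hd⟩ := ih hK
      refine ⟨fun i ↦ Nat.casesOn i G₀ G, fun i ↦ match i with
        | 0 => k ∘ₗ ε
        | i + 1 => d i, p, ?_, ?_, hkp.surjective, fun x ↦ (hkp.exact x).trans ?_, ?_⟩
      · rintro (_ | i)
        · exact hG₀
        · exact hG i
      · rintro (_ | i) hi
        · exact absurd hi (Nat.not_lt_zero _)
        · exact hG' i (Nat.lt_of_succ_lt_succ hi)
      · constructor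
        · rintro ⟨y, rfl⟩
          obtain ⟨z, rfl⟩ := hε y
          exact ⟨z, rfl⟩
        · rintro ⟨z, rfl⟩
          exact ⟨ε z, rfl⟩
      · rintro (_ | i)
        · intro x
          change k (ε x) = 0 ↔ _
          rw [map_eq_zero_iff k hkp.injective]
          exact hdε x
        · exact hd i

lemma HasGorensteinFlatResolution.mono {M : Type u} [AddCommGroup M] [Module R M] {m n : ℕ}
    (hmn : m ≤ n) (h : HasGorensteinFlatResolution R M m) : HasGorensteinFlatResolution R M n := by
  obtain ⟨G, d, ε, hG, hG', h⟩ := h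
  exact ⟨G, d, ε, hG, fun i hi ↦ hG' i (hmn.trans_lt hi), h⟩

lemma gorensteinFlatDim_le_iff {n : ℕ} {M : ModuleCat.{u} R} :
    gorensteinFlatDim R M ≤ n ↔ GorensteinFlatDimLE n M := by
  rw [← hasGorensteinFlatResolution_iff]
  constructor
  · intro h
    by_contra hn
    have : ((n + 1 : ℕ) : ℕ∞) ≤ gorensteinFlatDim R M := by
      refine le_iInf₂ fun m hm ↦ ?_
      by_contra hlt
      rw [Nat.cast_le, not_le] at hlt
      exact hn (hm.mono (Nat.le_of_lt_succ hlt))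
    have := this.trans h
    rw [Nat.cast_le] at this
    exact Nat.not_succ_le_self n this
  · exact fun h ↦ iInf₂_le n h

namespace GorensteinFlatDimLE

lemma of_isGorensteinFlat {M : ModuleCat.{u} R} (h : IsGorensteinFlat R M) (n : ℕ) :
    GorensteinFlatDimLE n M :=
  hasGorensteinFlatResolution_iff.1
    ((hasGorensteinFlatResolution_iff (n := 0).2 h).mono (Nat.zero_le n))

lemma of_subsingleton (M : ModuleCat.{u} R) [Subsingleton M] (n : ℕ) : GorensteinFlatDimLE n M :=
  of_isGorensteinFlat (.of_subsingleton M) n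

lemma of_equiv {n : ℕ} {M M' : ModuleCat.{u} R} (e : M ≃ₗ[R] M') (h : GorensteinFlatDimLE n M) :
    GorensteinFlatDimLE n M' := by
  cases n with
  | zero => exact IsGorensteinFlat.of_equiv e h
  | succ n =>
    obtain ⟨K, G, k, p, hG, hkp, hK⟩ := h
    refine ⟨K, G, k, e.toLinearMap ∘ₗ p, hG, ⟨hkp.injective, fun x ↦ ?_,
      e.surjective.comp hkp.surjective⟩, hK⟩
    rw [← hkp.exact x]
    exact map_eq_zero_iff e e.injective

/-- The modules of dimension at most `n` are closed under extensions and kernels of surjections. In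
the inductive step, comparing two presentations by a pullback shows that the kernel of every
surjection from a Gorenstein flat module has dimension at most `n`, so that both properties
follow from those of the kernels in the horseshoe lemma. -/
lemma iff_of_isShortExact (hR : IsRightCoherent R) (n : ℕ) {A B C : ModuleCat.{u} R} {f : A →ₗ[R] B}
    {g : B →ₗ[R] C} (h : IsShortExact f g) (hC : GorensteinFlatDimLE n C) :
    GorensteinFlatDimLE n A ↔ GorensteinFlatDimLE n B := by
  induction n generalizing A B C with
  | zero => exact ⟨fun hA ↦ .of_isShortExact hR h hA hC, fun hB ↦ .of_isShortExact_left hR h hB hC⟩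
  | succ n ih =>
    have syzygy : ∀ {K G M : ModuleCat.{u} R} {k : K →ₗ[R] G} {p : G →ₗ[R] M}, IsShortExact k p →
        IsGorensteinFlat R G → GorensteinFlatDimLE (n + 1) M → GorensteinFlatDimLE n K := by
      rintro K G M k p hkp hG ⟨K', G', k', p', hG', hkp', hK'⟩
      obtain ⟨P, j, q, k₁, r, hjq, hkr⟩ := hkp.exists_pullback hkp'
      exact (ih hjq (of_isGorensteinFlat hG' n)).2 ((ih hkr (of_isGorensteinFlat hG n)).1 hK')
    obtain ⟨K, P, k, α, hP, hα⟩ := IsShortExact.exists_projective_presentation A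
    obtain ⟨K', P', k', γ, hP', hγ⟩ := IsShortExact.exists_projective_presentation C
    obtain ⟨L, l, β, s, t, hβ, hst⟩ := h.exists_horseshoe hα hγ
    have hGP : IsGorensteinFlat R P := .of_isFlatLeft (.of_projective P)
    have hGP' : IsGorensteinFlat R P' := .of_isFlatLeft (.of_projective P')
    have hGPP : IsGorensteinFlat R (ModuleCat.of R (P × P')) :=
      .of_isFlatLeft (A := ModuleCat.of R (P × P')) (.of_projective (P × P'))
    have hK := ih hst (syzygy hγ hGP' hC)
    exact ⟨fun hA ↦ ⟨L, ModuleCat.of R (P × P'), l, β, hGPP, hβ, hK.1 (syzygy hα hGP hA)⟩,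
      fun hB ↦ ⟨K, P, k, α, hGP, hα,
        hK.2 (syzygy (G := ModuleCat.of R (P × P')) hβ hGPP hB)⟩⟩

lemma dfinsupp {J : Type u} [DecidableEq J] {n : ℕ} {M : J → ModuleCat.{u} R}
    (h : ∀ j, GorensteinFlatDimLE n (M j)) :
    GorensteinFlatDimLE n (ModuleCat.of R (Π₀ j, M j)) := by
  induction n generalizing M with
  | zero => exact IsGorensteinFlat.dfinsupp h
  | succ n ih =>
    choose K G k p hG hkp hK using h
    exact ⟨ModuleCat.of R (Π₀ j, K j), ModuleCat.of R (Π₀ j, G j), _, _,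
      IsGorensteinFlat.dfinsupp hG, .mapRange hkp, ih hK⟩

/-- The Eilenberg swindle: `A` is the kernel of the endomorphism of the countable direct sum of
copies of `A × B` that shifts the components in `A`. -/
lemma exists_isShortExact_swindle (A B : Type u) [AddCommGroup A] [Module R A] [AddCommGroup B]
    [Module R B] : ∃ (f : A →ₗ[R] ℕ →₀ A × B) (g : (ℕ →₀ A × B) →ₗ[R] ℕ →₀ A × B),
      IsShortExact f g := by
  let fst : (ℕ →₀ A × B) →ₗ[R] ℕ →₀ A := Finsupp.mapRange.linearMap (LinearMap.fst R A B)
  let snd : (ℕ →₀ A × B) →ₗ[R] ℕ →₀ B := Finsupp.mapRange.linearMap (LinearMap.snd R A B)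
  let inl : (ℕ →₀ A) →ₗ[R] ℕ →₀ A × B := Finsupp.mapRange.linearMap (LinearMap.inl R A B)
  let inr : (ℕ →₀ B) →ₗ[R] ℕ →₀ A × B := Finsupp.mapRange.linearMap (LinearMap.inr R A B)
  let shift : (ℕ →₀ A) →ₗ[R] ℕ →₀ A := Finsupp.lcomapDomain Nat.succ Nat.succ_injective
  let g := inl ∘ₗ shift ∘ₗ fst + inr ∘ₗ snd
  have hg : ∀ x i, g x i = ((x (i + 1)).1, (x i).2) := by
    intro x i
    simp [g, inl, inr, fst, snd, shift, Finsupp.lcomapDomain]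
  refine ⟨Finsupp.lsingle 0 ∘ₗ LinearMap.inl R A B, g,
    (Finsupp.single_injective 0).comp LinearMap.inl_injective, fun x ↦ ⟨fun hx ↦ ?_, ?_⟩, ?_⟩
  · have hx' : ∀ i, ((x (i + 1)).1, (x i).2) = (0 : A × B) := fun i ↦ by
      rw [← hg, hx, Finsupp.zero_apply]
    refine ⟨(x 0).1, Finsupp.ext fun i ↦ ?_⟩
    cases i with
    | zero =>
      have h0 : (x 0).2 = 0 := congrArg Prod.snd (hx' 0)
      ext <;> simp [h0]
    | succ i =>
      have h1 : (x (i + 1)).1 = 0 := congrArg Prod.fst (hx' i)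
      have h2 : (x (i + 1)).2 = 0 := congrArg Prod.snd (hx' (i + 1))
      ext <;> simp [h1, h2]
  · rintro ⟨a, rfl⟩
    ext i
    · simp [hg]
    · rw [hg]
      cases i <;> simp
  · intro y
    refine ⟨inl (Finsupp.mapDomain Nat.succ (fst y)) + inr (snd y), Finsupp.ext fun i ↦ ?_⟩
    rw [hg]
    have : Finsupp.mapDomain Nat.succ (fst y) (i + 1) = fst y i :=
      Finsupp.mapDomain_apply Nat.succ_injective (fst y) i
    ext <;> simp [inl, inr, this] <;> simp [fst, snd]

/-- Over a right coherent ring, a direct summand has at most the dimension of the module. -/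
lemma of_prod (hR : IsRightCoherent R) {n : ℕ} {A B : ModuleCat.{u} R}
    (h : GorensteinFlatDimLE n (ModuleCat.of R (A × B))) : GorensteinFlatDimLE n A := by
  classical
  obtain ⟨f, g, hfg⟩ := exists_isShortExact_swindle (R := R) A B
  -- the index set is lifted to the universe of the ring
  let e : (Π₀ _ : ULift.{u} ℕ, A × B) ≃ₗ[R] ULift.{u} ℕ →₀ A × B :=
    (finsuppLequivDFinsupp R).symm
  have hW : GorensteinFlatDimLE n (ModuleCat.of R (ℕ →₀ A × B)) :=
    of_equiv (M := ModuleCat.of R (Π₀ _ : ULift.{u} ℕ, A × B))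
      (e ≪≫ₗ Finsupp.domLCongr Equiv.ulift)
      (dfinsupp (M := fun _ : ULift.{u} ℕ ↦ ModuleCat.of R (A × B)) fun _ ↦ h)
  exact (iff_of_isShortExact hR n (B := ModuleCat.of R (ℕ →₀ A × B))
    (C := ModuleCat.of R (ℕ →₀ A × B)) hfg hW).2 hW

end GorensteinFlatDimLE

end Dimension

/-! ### Semiprimary rings -/

section Semiprimary

variable {R : Type u} [Ring R] {N : Ideal R} [N.IsTwoSided]

lemma IsSemiprimaryWithRadical.isSemisimpleModule (hN : IsSemiprimaryWithRadical R N) {M : Type*}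
    [AddCommGroup M] [Module R M] (hM : Module.IsTorsionBySet R M N) : IsSemisimpleModule R M := by
  have := hN.isSemisimpleRing
  let := hM.module
  exact hM.isSemisimpleModule_iff.1 inferInstance

/-- A bound for the simple modules holds for all modules `M`, by induction along the filtration of
`M` by the submodules `Nⁱ M`, whose factors are direct sums of simple modules. -/
lemma IsSemiprimaryWithRadical.gorensteinFlatDimLE (hN : IsSemiprimaryWithRadical R N)
    (hR : IsRightCoherent R) {n : ℕ}
    (h : ∀ C : ModuleCat.{u} R, IsSimpleModule R C → GorensteinFlatDimLE n C)
    (M : ModuleCat.{u} R) : GorensteinFlatDimLE n M := by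
  classical
  obtain ⟨k, hk⟩ := hN.isNilpotent
  have key : ∀ (k : ℕ) (M : ModuleCat.{u} R), (N ^ k • ⊤ : Submodule R M) = ⊥ →
      GorensteinFlatDimLE n M := by
    intro k
    induction k with
    | zero =>
      intro M hM
      rw [Submodule.pow_zero, Ideal.one_eq_top, Submodule.top_smul] at hM
      have : Subsingleton M := (Submodule.subsingleton_iff R).1 (subsingleton_of_bot_eq_top hM.symm)
      exact .of_subsingleton M n
    | succ k ih =>
      intro M hM
      let S : Submodule R M := N • ⊤
      have hS : GorensteinFlatDimLE n (ModuleCat.of R S) := by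
        refine ih _ ?_
        apply Submodule.map_injective_of_injective S.injective_subtype
        rw [Submodule.map_smul'', Submodule.map_top, Submodule.range_subtype, Submodule.map_bot,
          ← hM, Submodule.pow_succ, Submodule.mul_smul]
      have hMS : GorensteinFlatDimLE n (ModuleCat.of R (M ⧸ S)) := by
        have := hN.isSemisimpleModule (M := M ⧸ S) (Module.isTorsionBySet_quotient_ideal_smul M N)
        obtain ⟨s, e, -, hs⟩ := IsSemisimpleModule.exists_linearEquiv_dfinsupp R (M ⧸ S)
        exact .of_equiv (M := ModuleCat.of R (Π₀ m : s, m.1)) e.symm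
          (.dfinsupp (M := fun m : s ↦ ModuleCat.of R m.1) fun m ↦ h _ (hs m))
      exact (GorensteinFlatDimLE.iff_of_isShortExact hR n (A := ModuleCat.of R S)
        (C := ModuleCat.of R (M ⧸ S)) (f := S.subtype) (g := S.mkQ)
        ⟨S.injective_subtype, LinearMap.exact_subtype_mkQ S, S.mkQ_surjective⟩ hMS).1 hS
  refine key k M ?_
  rw [hk, Submodule.zero_eq_bot, Submodule.bot_smul]

/-- Every simple module is a direct summand of `R ⧸ N`. -/
lemma IsSemiprimaryWithRadical.exists_prod_equiv (hN : IsSemiprimaryWithRadical R N) (C : Type u)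
    [AddCommGroup C] [Module R C] [IsSimpleModule R C] :
    ∃ B : ModuleCat.{u} R, Nonempty ((R ⧸ N) ≃ₗ[R] C × B) := by
  have hNC : (N • ⊤ : Submodule R C) = ⊥ := by
    refine (eq_bot_or_eq_top _).resolve_right fun htop ↦ ?_
    obtain ⟨k, hk⟩ := hN.isNilpotent
    have hpow : ∀ k : ℕ, (N ^ k • ⊤ : Submodule R C) = ⊤ := fun k ↦ by
      induction k with
      | zero => rw [Submodule.pow_zero, Ideal.one_eq_top, Submodule.top_smul]
      | succ k ih => rw [Submodule.pow_succ, Submodule.mul_smul, htop, ih]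
    have := hpow k
    rw [hk, Submodule.zero_eq_bot, Submodule.bot_smul] at this
    exact bot_ne_top this
  have := IsSimpleModule.nontrivial R C
  obtain ⟨c, hc⟩ := exists_ne (0 : C)
  let p : (R ⧸ N) →ₗ[R] C := Submodule.liftQ N (LinearMap.toSpanSingleton R C c) fun r hr ↦ by
    rw [LinearMap.mem_ker, ← Submodule.mem_bot R, ← hNC]
    exact Submodule.smul_mem_smul hr Submodule.mem_top
  have hp : Function.Surjective p := fun x ↦ by
    obtain ⟨r, rfl⟩ := IsSimpleModule.toSpanSingleton_surjective R hc x
    exact ⟨Submodule.Quotient.mk r, rfl⟩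
  have htors : Module.IsTorsionBySet R (R ⧸ N) N := fun x r ↦ by
    obtain ⟨x, rfl⟩ := Submodule.Quotient.mk_surjective N x
    rw [← Submodule.Quotient.mk_smul, Submodule.Quotient.mk_eq_zero]
    exact N.mul_mem_right x r.2
  have := hN.isSemisimpleModule htors
  obtain ⟨Q, hQ⟩ := exists_isCompl (LinearMap.ker p)
  let e : Q ≃ₗ[R] C :=
    (Submodule.quotientEquivOfIsCompl _ Q hQ).symm ≪≫ₗ p.quotKerEquivOfSurjective hp
  exact ⟨ModuleCat.of R (LinearMap.ker p), ⟨(Submodule.prodEquivOfIsCompl _ Q hQ).symm ≪≫ₗ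
    LinearEquiv.prodComm R _ _ ≪≫ₗ e.prodCongr (LinearEquiv.refl R _)⟩⟩

end Semiprimary

theorem theorem2 (R : Type u) [Ring R] (N : Ideal R) [N.IsTwoSided]
    (hN : IsSemiprimaryWithRadical R N) (hR : IsRightCoherent R) :
    leftGorensteinWeakDim R = gorensteinFlatDim R (R ⧸ N) ∧
    gorensteinFlatDim R (R ⧸ N) =
      ⨆ (C : ModuleCat.{u} R) (_ : IsSimpleModule R C), gorensteinFlatDim R C := by
  have h₁ : gorensteinFlatDim R (R ⧸ N) ≤ leftGorensteinWeakDim R :=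
    le_iSup (fun M : ModuleCat.{u} R ↦ gorensteinFlatDim R M) (ModuleCat.of R (R ⧸ N))
  have h₂ : leftGorensteinWeakDim R ≤
      ⨆ (C : ModuleCat.{u} R) (_ : IsSimpleModule R C), gorensteinFlatDim R C := by
    generalize hs : ⨆ (C : ModuleCat.{u} R) (_ : IsSimpleModule R C), gorensteinFlatDim R C = s
    induction s using ENat.recTopCoe with
    | top => exact le_top
    | coe n =>
      exact iSup_le fun M ↦ gorensteinFlatDim_le_iff.2 (hN.gorensteinFlatDimLE hR
        (fun C hC ↦ gorensteinFlatDim_le_iff.1 (hs ▸ le_iSup₂ (f := fun (C : ModuleCat.{u} R)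
          (_ : IsSimpleModule R C) ↦ gorensteinFlatDim R C) C hC)) M)
  have h₃ : ⨆ (C : ModuleCat.{u} R) (_ : IsSimpleModule R C), gorensteinFlatDim R C ≤
      gorensteinFlatDim R (R ⧸ N) := by
    refine iSup₂_le fun C hC ↦ ?_
    generalize hs : gorensteinFlatDim R (R ⧸ N) = s
    induction s using ENat.recTopCoe with
    | top => exact le_top
    | coe n =>
      obtain ⟨B, ⟨e⟩⟩ := hN.exists_prod_equiv C
      have h := (gorensteinFlatDim_le_iff (M := ModuleCat.of R (R ⧸ N))).1 hs.le
      exact gorensteinFlatDim_le_iff.2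
        (.of_prod hR (h.of_equiv (M' := ModuleCat.of R (C × B)) e))
  exact ⟨(h₂.trans h₃).antisymm h₁, (h₁.trans h₂).antisymm h₃⟩
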